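/- Let $\mathbb D$ be the open unit disc in $\mathbb C$, let $dA$ be area measure on $\mathbb D$, and for $s>-1$ put $dA_s(z)=(1-|z|^2)^s\,dA(z)$. Let $\mu$ be a nonzero finite positive Borel measure on $\partial\mathbb D$, let $$P_\mu(z)=\frac1{2\pi}\int_{\partial\mathbb D}\frac{1-|z|^2}{|\zeta-z|^2}\,d\mu(\zeta),\qquad z\in\mathbb D,$$ and let $D(\mu)$ be the Dirichlet-type space of all analytic functions $f$ on $\mathbb D$ with $$\int_{\mathbb D}|f'(z)|^2P_\mu(z)\,dA(z)<\infty.$$ Let $\sigma,\tau>-1$ and let $f$ be an analytic function on $\mathbb D$. Then $f\in D(\mu)$ if and only if $$\int_{\mathbb D}\int_{\mathbb D}\frac{|f(z)-f(w)|^2}{|1-\bar z w|^{4+\sigma+\tau}}\,P_\mu(z)\,dA_\sigma(z)\,dA_\tau(w)<\infty.$$ -/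

import Mathlib

open MeasureTheory Metric
open scoped ENNReal

noncomputable section

/-- Lebesgue area measure `dA` on the open unit disc of `ℂ`. -/
def diskArea : Measure ℂ :=
  volume.restrict (ball (0 : ℂ) 1)

/-- The weighted area measure `dA_σ(z) = (1 - |z|²)^σ dA(z)` on the open unit disc. -/
def weightedArea (σ : ℝ) : Measure ℂ :=
  diskArea.withDensity fun z => ENNReal.ofReal ((1 - ‖z‖ ^ 2) ^ σ)

/-- The Poisson integral
`P_μ(z) = (1 / 2π) ∫ (1 - |z|²) / |ζ - z|² dμ(ζ)` of a positive Borel measure `μ` on the unit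
circle. It is finite for `|z| < 1` when `μ` is finite, since there the integrand is bounded. -/
def poissonIntegral (μ : Measure (sphere (0 : ℂ) 1)) (z : ℂ) : ℝ≥0∞ :=
  (∫⁻ ζ : sphere (0 : ℂ) 1, ENNReal.ofReal ((1 - ‖z‖ ^ 2) / ‖(ζ : ℂ) - z‖ ^ 2) ∂μ)
    / ENNReal.ofReal (2 * Real.pi)

/-- The Dirichlet-type space `D(μ)` of a nonzero finite positive Borel measure `μ` on the unit
circle: the functions `f` that are analytic on the open unit disc and satisfy
`∫ |f'(z)|² P_μ(z) dA(z) < ∞`. Values of `f` outside the disc play no role. (For `μ = 0` the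
symbol `D(0)` conventionally stands for the Hardy space instead; that case is not covered by
this definition.) -/
def DirichletTypeSpace (μ : Measure (sphere (0 : ℂ) 1)) : Set (ℂ → ℂ) :=
  {f | AnalyticOnNhd ℂ f (ball 0 1) ∧
    ∫⁻ z, ENNReal.ofReal (‖deriv f z‖ ^ 2) * poissonIntegral μ z ∂diskArea < ∞}

end

/-!
Write `D` for the unit disc, `b = 4 + σ + τ`, and let the oscillation of `f` at `z` be
`∫ |f z - f w|² (1 - |w|²) ^ τ / |1 - z̄ w| ^ b dA(w)` over `D`. By Tonelli the double integral is
the integral over `z` of `P_μ(z) (1 - |z|²) ^ σ` times the oscillation at `z`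
(`double_lintegral_eq_oscillation`), and both directions are inequalities with constants that depend
on `σ` and `τ` only.

If the double integral is finite, then `f ∈ D(μ)` because
`|f' z|² ≤ C (1 - |z|²) ^ σ` times the oscillation at `z`, for every `z`
(`exists_deriv_le_oscillation_bound`). Only the `w` in a disc about `z` of radius comparable to
`1 - |z|²` are needed: there the weight is essentially constant, and the mean value property applies
to the square of the difference quotient of `f` at `z`.

The converse rests on two facts.

* The oscillation at `z` is at most a constant times
  `∫ |f' w|² (1 - |w|²) ^ (2 + τ) / |1 - z̄ w| ^ b dA(w)`, uniformly in `z`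
  (`exists_oscillation_le_deriv_bound`). The disc involution interchanging `0` and `z` turns this
  into a bound for `g u - g 0` by `g'` with the weights `(1 - |u|²) ^ τ |1 - z̄ u| ^ (σ - τ)` and
  `(1 - |u|²) ^ (2 + τ) |1 - z̄ u| ^ (σ - τ)`. Along a ray it is a one-dimensional Hardy inequality:
  with `t = 1 - r` and `a` the value of `|1 - z̄ u|` at the end of the ray, the weights are
  comparable to `E ^ 2 / t` and `t E ^ 2` for `E = t ^ ((1 + τ) / 2) (t + a) ^ ((σ - τ) / 2)`, and
  `t E' ≥ m E` with `m > 0` independent of `a` precisely because `σ, τ > -1`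
  (`hardy_setLIntegral_le`). The polar density `r` is lost near the origin and is recovered from the
  sub-mean value property of `|g'|²` (`exists_disc_hardy_bound`).
* For `|ζ| = 1`, integrating the Poisson kernel at `ζ` against `(1 - |z|²) ^ σ / |1 - z̄ w| ^ b` in
  `z` gives at most a constant times `(1 - |w|²) ^ (-2 - τ)` times the Poisson kernel at `w`
  (`exists_poisson_area_bound`). The inequality `|ζ - w|² ≤ 2 |ζ - z|² + 2 |1 - z̄ w|²` separates the
  two poles, after which the angular integral is that of a Poisson kernel and the radial one is
  dominated by an explicit derivative. Averaging over `ζ` gives the same bound for `P_μ`.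

Combining them and exchanging the order of integration, the powers of `1 - |w|²` cancel and
`∫ |f'|² P_μ dA` remains.
-/

/-! ### Circle means and polar coordinates -/

theorem polarCoord_symm_eq_circleMap (p : ℝ × ℝ) :
    Complex.polarCoord.symm p = circleMap 0 p.1 p.2 := by
  rw [Complex.polarCoord_symm_apply, circleMap_zero, Complex.exp_mul_I]
  simp

theorem measurable_circleMap_prod (c : ℂ) :
    Measurable fun p : ℝ × ℝ => circleMap c p.1 p.2 := by
  unfold circleMap
  fun_prop

/-- Integration over a disc in polar coordinates around its centre. -/
theorem setLIntegral_ball_eq_polar {F : ℂ → ℝ≥0∞} (hF : Measurable F) (c : ℂ) (R : ℝ) :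
    ∫⁻ u in ball c R, F u =
      ∫⁻ r in Set.Ioo 0 R, ENNReal.ofReal r *
        ∫⁻ θ in Set.Ioo (-Real.pi) Real.pi, F (circleMap c r θ) := by
  have hm := measurable_circleMap_prod c
  calc ∫⁻ u in ball c R, F u
      = ∫⁻ u, (ball c R).indicator F u := (lintegral_indicator measurableSet_ball _).symm
    _ = ∫⁻ u, (ball c R).indicator F (c + u) := (lintegral_add_left_eq_self _ c).symm
    _ = ∫⁻ p in Set.Ioi (0 : ℝ) ×ˢ Set.Ioo (-Real.pi) Real.pi,
          ENNReal.ofReal p.1 * (ball c R).indicator F (circleMap c p.1 p.2) := by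
        rw [← Complex.lintegral_comp_polarCoord_symm]
        have h2 : ∀ p : ℝ × ℝ, c + Complex.polarCoord.symm p = circleMap c p.1 p.2 := by
          intro p
          rw [polarCoord_symm_eq_circleMap]
          simp [circleMap]
        simp only [h2, smul_eq_mul]
        rfl
    _ = ∫⁻ r in Set.Ioi (0 : ℝ), ∫⁻ θ in Set.Ioo (-Real.pi) Real.pi,
          ENNReal.ofReal r * (ball c R).indicator F (circleMap c r θ) := by
        rw [Measure.volume_eq_prod, ← Measure.prod_restrict, lintegral_prod]
        exact ((by fun_prop : Measurable fun p : ℝ × ℝ => ENNReal.ofReal p.1).mul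
          ((hF.indicator measurableSet_ball).comp hm)).aemeasurable
    _ = ∫⁻ r in Set.Ioi (0 : ℝ), (Set.Ioo 0 R).indicator (fun r => ENNReal.ofReal r *
          ∫⁻ θ in Set.Ioo (-Real.pi) Real.pi, F (circleMap c r θ)) r := by
        refine setLIntegral_congr_fun measurableSet_Ioi fun r hr => ?_
        have hr0 : 0 < r := hr
        have hd : ∀ θ, circleMap c r θ ∈ ball c R ↔ r < R := fun θ => by
          simp [dist_eq_norm, circleMap, abs_of_pos hr0]
        by_cases h : r < R
        · simp only [Set.indicator, hd, h, if_true, Set.mem_Ioo, hr0, true_and]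
          exact lintegral_const_mul _ (hF.comp (by unfold circleMap; fun_prop))
        · simp [Set.indicator, hd, h]
    _ = _ := by
        rw [lintegral_indicator measurableSet_Ioo, Measure.restrict_restrict measurableSet_Ioo]
        congr 2
        ext r
        simp +contextual

/-- The mean value property over a circle, parametrised by `(-π, π)`. -/
theorem integral_circleMap_eq {h : ℂ → ℂ} {c : ℂ} {r R : ℝ} (hr : 0 < r) (hrR : r < R)
    (hh : DifferentiableOn ℂ h (ball c R)) :
    ∫ θ in (-Real.pi)..Real.pi, h (circleMap c r θ) = 2 * Real.pi * h c := by
  have hsub : closedBall c |r| ⊆ ball c R := by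
    rw [abs_of_pos hr]
    exact closedBall_subset_ball hrR
  have h1 : Real.circleAverage h c r = h c :=
    DiffContOnCl.circleAverage ((hh.mono hsub).diffContOnCl_ball subset_rfl)
  rw [Real.circleAverage_def] at h1
  have hper : Function.Periodic (fun θ => h (circleMap c r θ)) (2 * Real.pi) := fun θ => by
    simp only
    rw [periodic_circleMap c r θ]
  have h2 := hper.intervalIntegral_add_eq (-Real.pi) 0
  rw [show -Real.pi + 2 * Real.pi = Real.pi by ring, zero_add] at h2
  rw [h2, ← h1]
  have : (Real.pi : ℂ) ≠ 0 := by exact_mod_cast Real.pi_ne_zero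
  simp only [Complex.real_smul]
  push_cast
  field_simp

/-- The sub-mean value property of `‖h‖` over a circle. -/
theorem setLIntegral_circle_ge {h : ℂ → ℂ} {c : ℂ} {r R : ℝ} (hr : 0 < r) (hrR : r < R)
    (hh : DifferentiableOn ℂ h (ball c R)) :
    ENNReal.ofReal (2 * Real.pi) * ‖h c‖ₑ ≤
      ∫⁻ θ in Set.Ioo (-Real.pi) Real.pi, ‖h (circleMap c r θ)‖ₑ := by
  have h1 := integral_circleMap_eq hr hrR hh
  rw [intervalIntegral.integral_of_le (by linarith [Real.pi_pos]), integral_Ioc_eq_integral_Ioo]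
    at h1
  calc ENNReal.ofReal (2 * Real.pi) * ‖h c‖ₑ = ‖(2 * Real.pi * h c : ℂ)‖ₑ := by
        rw [enorm_mul]
        congr 1
        rw [← ofReal_norm]
        congr 1
        simp [abs_of_pos Real.pi_pos]
    _ ≤ _ := by
        rw [← h1]
        exact enorm_integral_le_lintegral_enorm _

theorem DifferentiableOn.measurable_indicator_ball {h : ℂ → ℂ} {c : ℂ} {R : ℝ}
    (hh : DifferentiableOn ℂ h (ball c R)) : Measurable ((ball c R).indicator h) := by
  classical
  rw [← Set.piecewise_eq_indicator]
  exact hh.continuousOn.measurable_piecewise continuousOn_const measurableSet_ball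

/-- Sub-mean value property of `|h|²` with respect to a radial weight on a disc. -/
theorem enorm_sq_mul_le_setLIntegral_ball {h : ℂ → ℂ} {c : ℂ} {R : ℝ}
    (hh : DifferentiableOn ℂ h (ball c R)) {k : ℝ → ℝ≥0∞} (hk : Measurable k) :
    ‖h c‖ₑ ^ 2 * (ENNReal.ofReal (2 * Real.pi) * ∫⁻ r in Set.Ioo 0 R, ENNReal.ofReal r * k r) ≤
      ∫⁻ u in ball c R, ‖h u‖ₑ ^ 2 * k ‖u - c‖ := by
  have hm := hh.measurable_indicator_ball
  have hF : Measurable fun u => ‖(ball c R).indicator h u‖ₑ ^ 2 * k ‖u - c‖ := by fun_prop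
  calc _ = ∫⁻ r in Set.Ioo 0 R, ENNReal.ofReal r *
        ((ENNReal.ofReal (2 * Real.pi) * ‖h c‖ₑ ^ 2) * k r) := by
        rw [← mul_assoc, ← lintegral_const_mul _ (by fun_prop)]
        refine lintegral_congr fun r => by ring
    _ ≤ ∫⁻ r in Set.Ioo 0 R, ENNReal.ofReal r *
        ∫⁻ θ in Set.Ioo (-Real.pi) Real.pi, ‖(ball c R).indicator h (circleMap c r θ)‖ₑ ^ 2 *
          k ‖circleMap c r θ - c‖ := by
        refine setLIntegral_mono' measurableSet_Ioo fun r hr => ?_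
        have hn : ∀ θ, ‖circleMap c r θ - c‖ = r := fun θ => by
          simp [circleMap, abs_of_pos hr.1]
        have hmem : ∀ θ, circleMap c r θ ∈ ball c R := fun θ => by
          rw [mem_ball, dist_eq_norm, hn]
          exact hr.2
        have hmθ : Measurable fun θ => ‖(ball c R).indicator h (circleMap c r θ)‖ₑ ^ 2 :=
          (hm.comp (by unfold circleMap; fun_prop : Measurable (circleMap c r))).enorm.pow_const 2
        simp only [hn]
        rw [lintegral_mul_const _ hmθ]
        simp only [Set.indicator_of_mem (hmem _)]
        have := setLIntegral_circle_ge hr.1 hr.2 (hh.pow 2)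
        simp only [Pi.pow_apply, enorm_pow] at this
        gcongr
    _ = ∫⁻ u in ball c R, ‖(ball c R).indicator h u‖ₑ ^ 2 * k ‖u - c‖ :=
        (setLIntegral_ball_eq_polar hF c R).symm
    _ = _ := setLIntegral_congr_fun measurableSet_ball fun u hu => by
        simp only [Set.indicator_of_mem hu]

/-- The integral of the Poisson kernel over a circle, in the form of an upper bound that is
uniform in `‖ρ‖ ≤ 1`. -/
theorem setLIntegral_circle_inv_sq_le {ρ : ℂ} (hρ : ‖ρ‖ ≤ 1) {r : ℝ} (hr : 0 < r) (hr1 : r < 1) :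
    ∫⁻ θ in Set.Ioo (-Real.pi) Real.pi,
        ENNReal.ofReal ((‖1 - (starRingEnd ℂ) (circleMap 0 r θ) * ρ‖ ^ 2)⁻¹) ≤
      ENNReal.ofReal (2 * Real.pi / (1 - r ^ 2)) := by
  set σ := (starRingEnd ℂ) ρ with hσ
  have hσn : ‖σ‖ ≤ 1 := by rwa [hσ, RCLike.norm_conj]
  have hnorm : ∀ z : ℂ, ‖1 - (starRingEnd ℂ) z * ρ‖ = ‖1 - σ * z‖ := fun z => by
    rw [← RCLike.norm_conj]
    simp [hσ, mul_comm]
  have hlt : ∀ z ∈ ball (0 : ℂ) 1, ‖σ * z‖ < 1 := fun z hz => by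
    rw [norm_mul]
    rw [mem_ball_zero_iff] at hz
    nlinarith [norm_nonneg σ, norm_nonneg z]
  have hne : ∀ z ∈ ball (0 : ℂ) 1, 1 - σ * z ≠ 0 := fun z hz h0 => by
    have := hlt z hz
    rw [← sub_eq_zero.1 h0] at this
    simp at this
  have hdiff : DifferentiableOn ℂ (fun z => (1 + σ * z) / (1 - σ * z)) (ball 0 1) :=
    DifferentiableOn.div (by fun_prop) (by fun_prop) hne
  have hmean := integral_circleMap_eq hr hr1 hdiff
  have hmem : ∀ θ, circleMap 0 r θ ∈ ball (0 : ℂ) 1 := fun θ => by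
    simp [circleMap, abs_of_pos hr, hr1]
  have hcont : Continuous fun θ => (1 + σ * circleMap 0 r θ) / (1 - σ * circleMap 0 r θ) :=
    Continuous.div (by fun_prop) (by fun_prop) fun θ => hne _ (hmem θ)
  have hre : ∫ θ in (-Real.pi)..Real.pi,
      ((1 + σ * circleMap 0 r θ) / (1 - σ * circleMap 0 r θ)).re = 2 * Real.pi := by
    have := congrArg Complex.re hmean
    rw [← Complex.reCLM_apply, ← ContinuousLinearMap.intervalIntegral_comp_comm _
      (hcont.intervalIntegrable _ _)] at this
    simpa using this
  have hrecont : Continuous fun θ =>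
      ((1 + σ * circleMap 0 r θ) / (1 - σ * circleMap 0 r θ)).re :=
    Complex.continuous_re.comp hcont
  rw [intervalIntegral.integral_of_le (by linarith [Real.pi_pos]), integral_Ioc_eq_integral_Ioo]
    at hre
  have h1r : 0 < 1 - r ^ 2 := by nlinarith
  have hkey : ∀ θ, (1 - r ^ 2) * (‖1 - σ * circleMap 0 r θ‖ ^ 2)⁻¹ ≤
      ((1 + σ * circleMap 0 r θ) / (1 - σ * circleMap 0 r θ)).re := fun θ => by
    set u := σ * circleMap 0 r θ with hu
    have hun : ‖u‖ ≤ r := by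
      rw [hu, norm_mul, norm_circleMap_zero, abs_of_pos hr]
      nlinarith
    have h3 : ((1 + u) / (1 - u)).re = (1 - ‖u‖ ^ 2) * (‖1 - u‖ ^ 2)⁻¹ := by
      rw [← Complex.normSq_eq_norm_sq, ← Complex.normSq_eq_norm_sq, Complex.div_re]
      simp [Complex.normSq_apply]
      ring
    rw [h3]
    gcongr
  rw [div_eq_mul_inv, mul_comm, ENNReal.ofReal_mul (by positivity), ← hre,
    ofReal_integral_eq_lintegral_ofReal (hrecont.integrableOn_Icc.mono_set Set.Ioo_subset_Icc_self),
    ← lintegral_const_mul' _ _ ENNReal.ofReal_ne_top]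
  · refine lintegral_mono fun θ => ?_
    rw [← ENNReal.ofReal_mul (by positivity), hnorm]
    refine ENNReal.ofReal_le_ofReal ?_
    rw [inv_mul_eq_div, le_div_iff₀ h1r, mul_comm]
    exact hkey θ
  · exact Filter.Eventually.of_forall fun θ => le_trans (by positivity) (hkey θ)

/-! ### Integrals of derivatives and a Hardy inequality -/

/-- A nonnegative function dominated by a derivative has integral at most the increment. -/
theorem setLIntegral_Ioo_le_of_hasDerivAt {F F' G : ℝ → ℝ} {x y C : ℝ} (hxy : x ≤ y)
    (hF : ContinuousOn F (Set.Icc x y)) (hF' : ∀ t ∈ Set.Ioo x y, HasDerivAt F (F' t) t)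
    (hC : 0 ≤ C) (hG : ∀ t ∈ Set.Ioo x y, 0 ≤ G t) (hGF : ∀ t ∈ Set.Ioo x y, C * G t ≤ F' t) :
    ENNReal.ofReal C * ∫⁻ t in Set.Ioo x y, ENNReal.ofReal (G t) ≤ ENNReal.ofReal (F y - F x) := by
  have hpos : ∀ t ∈ Set.Ioo x y, 0 ≤ F' t := fun t ht =>
    (mul_nonneg hC (hG t ht)).trans (hGF t ht)
  have hint := intervalIntegral.integrableOn_deriv_of_nonneg hF hF' hpos
  rw [← lintegral_const_mul' _ _ ENNReal.ofReal_ne_top]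
  calc _ ≤ ∫⁻ t in Set.Ioo x y, ENNReal.ofReal (F' t) := by
        refine setLIntegral_mono' measurableSet_Ioo fun t ht => ?_
        rw [← ENNReal.ofReal_mul hC]
        exact ENNReal.ofReal_le_ofReal (hGF t ht)
    _ = ENNReal.ofReal (∫ t in Set.Ioo x y, F' t) := by
        rw [ofReal_integral_eq_lintegral_ofReal (hint.mono_set Set.Ioo_subset_Ioc_self)]
        exact (ae_restrict_iff' measurableSet_Ioo).2 (Filter.Eventually.of_forall hpos)
    _ = _ := by
        rw [← integral_Ioc_eq_integral_Ioo, ← intervalIntegral.integral_of_le hxy,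
          intervalIntegral.integral_eq_sub_of_hasDerivAt_of_le hxy hF hF'
            ((intervalIntegrable_iff_integrableOn_Ioc_of_le hxy).2 hint)]

/-- Cauchy-Schwarz with a positive weight `H`. -/
theorem sq_lintegral_le_mul_weight {α : Type*} [MeasurableSpace α] {ν : Measure α} {φ : α → ℝ≥0∞}
    (hφ : Measurable φ) {H : α → ℝ} (hH : AEMeasurable H ν) (hpos : ∀ᵐ x ∂ν, 0 < H x) :
    (∫⁻ x, φ x ∂ν) ^ 2 ≤
      (∫⁻ x, φ x ^ 2 * ENNReal.ofReal (H x) ∂ν) * ∫⁻ x, ENNReal.ofReal (H x)⁻¹ ∂ν := by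
  have hCS := ENNReal.lintegral_mul_le_Lp_mul_Lq ν Real.HolderConjugate.two_two
    (f := fun x => φ x * ENNReal.ofReal √(H x)) (g := fun x => ENNReal.ofReal (√(H x))⁻¹)
    (by fun_prop) (by fun_prop)
  have h1 : ∫⁻ x, φ x ∂ν ≤
      ∫⁻ x, ((fun x => φ x * ENNReal.ofReal √(H x)) * fun x => ENNReal.ofReal (√(H x))⁻¹) x ∂ν := by
    refine lintegral_mono_ae (hpos.mono fun x hx => ?_)
    simp only [Pi.mul_apply]
    rw [mul_assoc, ← ENNReal.ofReal_mul (by positivity), mul_inv_cancel₀ (by positivity)]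
    simp
  have h2 : ∫⁻ x, (φ x * ENNReal.ofReal √(H x)) ^ (2 : ℝ) ∂ν =
      ∫⁻ x, φ x ^ 2 * ENNReal.ofReal (H x) ∂ν := by
    refine lintegral_congr_ae (hpos.mono fun x hx => ?_)
    simp only
    rw [ENNReal.rpow_two, mul_pow, ← ENNReal.ofReal_pow (by positivity), Real.sq_sqrt hx.le]
  have h3 : ∫⁻ x, ENNReal.ofReal (√(H x))⁻¹ ^ (2 : ℝ) ∂ν = ∫⁻ x, ENNReal.ofReal (H x)⁻¹ ∂ν := by
    refine lintegral_congr_ae (hpos.mono fun x hx => ?_)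
    simp only
    rw [ENNReal.rpow_two, ← ENNReal.ofReal_pow (by positivity), inv_pow, Real.sq_sqrt hx.le]
  rw [h2, h3] at hCS
  calc _ ≤ ((∫⁻ x, φ x ^ 2 * ENNReal.ofReal (H x) ∂ν) ^ (1 / 2 : ℝ) *
        (∫⁻ x, ENNReal.ofReal (H x)⁻¹ ∂ν) ^ (1 / 2 : ℝ)) ^ 2 := by
        gcongr
        exact h1.trans hCS
    _ = _ := by
        rw [mul_pow, ← ENNReal.rpow_two, ← ENNReal.rpow_two, ← ENNReal.rpow_mul, ← ENNReal.rpow_mul]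
        norm_num

/-- Tonelli's theorem on the triangle `0 < s < r < 1`. -/
theorem setLIntegral_triangle_swap {A B : ℝ → ℝ≥0∞} (hA : Measurable A) (hB : Measurable B) :
    ∫⁻ r in Set.Ioo (0 : ℝ) 1, (∫⁻ s in Set.Ioo 0 r, A s) * B r =
      ∫⁻ s in Set.Ioo (0 : ℝ) 1, A s * ∫⁻ r in Set.Ioo s 1, B r := by
  have hset : MeasurableSet {p : ℝ × ℝ | p.2 < p.1} := measurableSet_lt measurable_snd measurable_fst
  have hmeas : Measurable (Function.uncurry fun r s : ℝ =>
      {p : ℝ × ℝ | p.2 < p.1}.indicator (fun p => A p.2 * B p.1) (r, s)) :=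
    Measurable.indicator (by fun_prop) hset
  have hl : ∀ r ∈ Set.Ioo (0 : ℝ) 1, (∫⁻ s in Set.Ioo 0 r, A s) * B r = ∫⁻ s in Set.Ioo (0 : ℝ) 1,
      {p : ℝ × ℝ | p.2 < p.1}.indicator (fun p => A p.2 * B p.1) (r, s) := fun r hr => by
    rw [← lintegral_mul_const _ hA, show Set.Ioo 0 r = Set.Iio r ∩ Set.Ioo 0 1 by
      ext s; simp only [Set.mem_Ioo, Set.mem_inter_iff, Set.mem_Iio]; grind,
      ← Measure.restrict_restrict measurableSet_Iio, ← lintegral_indicator measurableSet_Iio]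
    rfl
  have hr : ∀ s ∈ Set.Ioo (0 : ℝ) 1, A s * (∫⁻ r in Set.Ioo s 1, B r) = ∫⁻ r in Set.Ioo (0 : ℝ) 1,
      {p : ℝ × ℝ | p.2 < p.1}.indicator (fun p => A p.2 * B p.1) (r, s) := fun s hs => by
    rw [← lintegral_const_mul _ hB, show Set.Ioo s 1 = Set.Ioi s ∩ Set.Ioo 0 1 by
      ext r; simp only [Set.mem_Ioo, Set.mem_inter_iff, Set.mem_Ioi]; grind,
      ← Measure.restrict_restrict measurableSet_Ioi, ← lintegral_indicator measurableSet_Ioi]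
    rfl
  rw [setLIntegral_congr_fun measurableSet_Ioo hl, setLIntegral_congr_fun measurableSet_Ioo hr]
  exact lintegral_lintegral_swap hmeas.aemeasurable

/-- A weighted Hardy inequality, written in terms of the distance `1 - r` to the right end point.
The Cauchy-Schwarz weight is `(1 - s) * E (1 - s)`: the growth condition on `E` makes both
`((1 - s) * E (1 - s))⁻¹` and `E (1 - r) / (1 - r)` dominated by exact derivatives. -/
theorem hardy_setLIntegral_le {E E' : ℝ → ℝ} {m : ℝ} (hm : 0 < m) (hEm : Measurable E)
    (hcont : ContinuousOn E (Set.Icc 0 1)) (h0 : 0 ≤ E 0) (hpos : ∀ t ∈ Set.Ioc (0 : ℝ) 1, 0 < E t)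
    (hderiv : ∀ t ∈ Set.Ioo (0 : ℝ) 1, HasDerivAt E (E' t) t)
    (hgrowth : ∀ t ∈ Set.Ioo (0 : ℝ) 1, m * E t ≤ t * E' t) {φ : ℝ → ℝ≥0∞} (hφ : Measurable φ) :
    ENNReal.ofReal m ^ 2 * ∫⁻ r in Set.Ioo (0 : ℝ) 1,
        (∫⁻ s in Set.Ioo 0 r, φ s) ^ 2 * ENNReal.ofReal (E (1 - r) ^ 2 / (1 - r)) ≤
      ∫⁻ s in Set.Ioo (0 : ℝ) 1, φ s ^ 2 * ENNReal.ofReal ((1 - s) * E (1 - s) ^ 2) := by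
  have hderiv' : ∀ r ∈ Set.Ioo (0 : ℝ) 1, HasDerivAt (fun r => E (1 - r)) (-E' (1 - r)) r :=
    fun r hr => by
      have := (hderiv (1 - r) ⟨by linarith [hr.2], by linarith [hr.1]⟩).scomp r
        ((hasDerivAt_id r).const_sub 1)
      exact this.congr_deriv (by simp)
  have hcont' : ContinuousOn (fun r => E (1 - r)) (Set.Icc 0 1) :=
    hcont.comp (by fun_prop) fun r hr => ⟨by linarith [hr.2], by linarith [hr.1]⟩
  have hpos' : ∀ r ∈ Set.Ico (0 : ℝ) 1, 0 < E (1 - r) := fun r hr =>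
    hpos _ ⟨by linarith [hr.2], by linarith [hr.1]⟩
  have hgrowth' : ∀ r ∈ Set.Ioo (0 : ℝ) 1, m * E (1 - r) ≤ (1 - r) * E' (1 - r) := fun r hr =>
    hgrowth _ ⟨by linarith [hr.2], by linarith [hr.1]⟩
  have hI1 : ∀ r ∈ Set.Ioo (0 : ℝ) 1, ENNReal.ofReal m *
      ∫⁻ s in Set.Ioo 0 r, ENNReal.ofReal ((1 - s) * E (1 - s))⁻¹ ≤
        ENNReal.ofReal (E (1 - r))⁻¹ := fun r hr => by
    refine (setLIntegral_Ioo_le_of_hasDerivAt (F := fun s => (E (1 - s))⁻¹)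
      (F' := fun s => E' (1 - s) / E (1 - s) ^ 2) hr.1.le ?_ ?_ hm.le ?_ ?_).trans ?_
    · exact (hcont'.mono (Set.Icc_subset_Icc_right hr.2.le)).inv₀ fun s hs =>
        (hpos' s ⟨hs.1, hs.2.trans_lt hr.2⟩).ne'
    · intro s hs
      have hs' : s ∈ Set.Ioo (0 : ℝ) 1 := ⟨hs.1, hs.2.trans hr.2⟩
      have := (hderiv' s hs').inv (hpos' s ⟨hs'.1.le, hs'.2⟩).ne'
      exact this.congr_deriv (by simp)
    · intro s hs
      have hs' : s ∈ Set.Ioo (0 : ℝ) 1 := ⟨hs.1, hs.2.trans hr.2⟩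
      have := hpos' s ⟨hs'.1.le, hs'.2⟩
      have := sub_pos.2 hs'.2
      positivity
    · intro s hs
      have hs' : s ∈ Set.Ioo (0 : ℝ) 1 := ⟨hs.1, hs.2.trans hr.2⟩
      have hE := hpos' s ⟨hs'.1.le, hs'.2⟩
      have h1s := sub_pos.2 hs'.2
      rw [← div_eq_mul_inv, div_le_div_iff₀ (by positivity) (by positivity)]
      nlinarith [hgrowth' s hs']
    · refine ENNReal.ofReal_le_ofReal ?_
      have := inv_pos.2 (hpos' 0 ⟨le_rfl, one_pos⟩)
      linarith
  have hI2 : ∀ s ∈ Set.Ioo (0 : ℝ) 1, ENNReal.ofReal m *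
      ∫⁻ r in Set.Ioo s 1, ENNReal.ofReal (E (1 - r) / (1 - r)) ≤
        ENNReal.ofReal (E (1 - s)) := fun s hs => by
    refine (setLIntegral_Ioo_le_of_hasDerivAt (F := fun r => -E (1 - r))
      (F' := fun r => E' (1 - r)) hs.2.le ?_ ?_ hm.le ?_ ?_).trans ?_
    · exact (hcont'.mono (Set.Icc_subset_Icc_left hs.1.le)).neg
    · intro r hr
      exact (hderiv' r ⟨hs.1.trans hr.1, hr.2⟩).neg.congr_deriv (by simp)
    · intro r hr
      have := hpos' r ⟨(hs.1.trans hr.1).le, hr.2⟩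
      have := sub_pos.2 hr.2
      positivity
    · intro r hr
      have h1r := sub_pos.2 hr.2
      rw [← mul_div_assoc, div_le_iff₀ h1r]
      nlinarith [hgrowth' r ⟨hs.1.trans hr.1, hr.2⟩]
    · refine ENNReal.ofReal_le_ofReal ?_
      simp only [sub_self]
      linarith
  have hstep : ∀ r ∈ Set.Ioo (0 : ℝ) 1, ENNReal.ofReal m *
      ((∫⁻ s in Set.Ioo 0 r, φ s) ^ 2 * ENNReal.ofReal (E (1 - r) ^ 2 / (1 - r))) ≤
      (∫⁻ s in Set.Ioo 0 r, φ s ^ 2 * ENNReal.ofReal ((1 - s) * E (1 - s))) *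
        ENNReal.ofReal (E (1 - r) / (1 - r)) := fun r hr => by
    have hCS := sq_lintegral_le_mul_weight (ν := volume.restrict (Set.Ioo 0 r)) hφ
      (H := fun s => (1 - s) * E (1 - s)) (by fun_prop) (by
        refine (ae_restrict_iff' measurableSet_Ioo).2 (Filter.Eventually.of_forall fun s hs => ?_)
        exact mul_pos (by linarith [hs.2, hr.2]) (hpos' s ⟨hs.1.le, hs.2.trans hr.2⟩))
    have hE := hpos' r ⟨hr.1.le, hr.2⟩
    have h1r := sub_pos.2 hr.2
    calc _ ≤ ENNReal.ofReal m * (((∫⁻ s in Set.Ioo 0 r, φ s ^ 2 *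
            ENNReal.ofReal ((1 - s) * E (1 - s))) *
            ∫⁻ s in Set.Ioo 0 r, ENNReal.ofReal ((1 - s) * E (1 - s))⁻¹) *
            ENNReal.ofReal (E (1 - r) ^ 2 / (1 - r))) := by gcongr
      _ = (∫⁻ s in Set.Ioo 0 r, φ s ^ 2 * ENNReal.ofReal ((1 - s) * E (1 - s))) *
            ((ENNReal.ofReal m * ∫⁻ s in Set.Ioo 0 r, ENNReal.ofReal ((1 - s) * E (1 - s))⁻¹) *
            ENNReal.ofReal (E (1 - r) ^ 2 / (1 - r))) := by ring
      _ ≤ (∫⁻ s in Set.Ioo 0 r, φ s ^ 2 * ENNReal.ofReal ((1 - s) * E (1 - s))) *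
            (ENNReal.ofReal (E (1 - r))⁻¹ * ENNReal.ofReal (E (1 - r) ^ 2 / (1 - r))) := by
          gcongr
          exact hI1 r hr
      _ = _ := by
          rw [← ENNReal.ofReal_mul (by positivity)]
          congr 2
          field_simp
  calc _ = ENNReal.ofReal m * ∫⁻ r in Set.Ioo (0 : ℝ) 1, ENNReal.ofReal m *
        ((∫⁻ s in Set.Ioo 0 r, φ s) ^ 2 * ENNReal.ofReal (E (1 - r) ^ 2 / (1 - r))) := by
        rw [lintegral_const_mul' _ _ ENNReal.ofReal_ne_top]
        ring
    _ ≤ ENNReal.ofReal m * ∫⁻ r in Set.Ioo (0 : ℝ) 1,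
        (∫⁻ s in Set.Ioo 0 r, φ s ^ 2 * ENNReal.ofReal ((1 - s) * E (1 - s))) *
          ENNReal.ofReal (E (1 - r) / (1 - r)) := by
        exact mul_le_mul_right (setLIntegral_mono' measurableSet_Ioo hstep) _
    _ = ∫⁻ s in Set.Ioo (0 : ℝ) 1, (φ s ^ 2 * ENNReal.ofReal ((1 - s) * E (1 - s))) *
          (ENNReal.ofReal m * ∫⁻ r in Set.Ioo s 1, ENNReal.ofReal (E (1 - r) / (1 - r))) := by
        rw [setLIntegral_triangle_swap (by fun_prop) (by fun_prop),
          ← lintegral_const_mul' _ _ ENNReal.ofReal_ne_top]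
        refine lintegral_congr fun s => by ring
    _ ≤ ∫⁻ s in Set.Ioo (0 : ℝ) 1, (φ s ^ 2 * ENNReal.ofReal ((1 - s) * E (1 - s))) *
          ENNReal.ofReal (E (1 - s)) := by
        refine setLIntegral_mono' measurableSet_Ioo fun s hs => ?_
        gcongr
        exact hI2 s hs
    _ = _ := by
        refine setLIntegral_congr_fun measurableSet_Ioo fun s hs => ?_
        have hE := hpos' s ⟨hs.1.le, hs.2⟩
        have h1s := sub_pos.2 hs.2
        rw [mul_assoc, ← ENNReal.ofReal_mul (by positivity)]
        congr 2
        ring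

theorem Real.rpow_le_rpow_abs_mul_rpow {x y K : ℝ} (c : ℝ) (hx : 0 < x) (hy : 0 < y) (hK : 1 ≤ K)
    (hxy : x ≤ K * y) (hyx : y ≤ K * x) : x ^ c ≤ K ^ |c| * y ^ c := by
  have hK0 : 0 < K := one_pos.trans_le hK
  rcases le_or_gt 0 c with hc | hc
  · rw [abs_of_nonneg hc, ← Real.mul_rpow hK0.le hy.le]
    exact Real.rpow_le_rpow hx.le hxy hc
  · rw [abs_of_neg hc, Real.rpow_neg hK0.le, ← Real.inv_rpow hK0.le,
      ← Real.mul_rpow (by positivity) hy.le]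
    refine Real.rpow_le_rpow_of_nonpos (by positivity) ?_ hc.le
    rw [inv_mul_le_iff₀ hK0]
    exact hyx

/-- The weighted Hardy inequality for `E t = t ^ α * (t + a) ^ β`, with a constant that does not
depend on `a`. -/
theorem hardy_rpow_setLIntegral_le {α β a : ℝ} (hα : 0 < α) (hαβ : 0 < α + β) (ha : 0 < a)
    {φ : ℝ → ℝ≥0∞} (hφ : Measurable φ) :
    ENNReal.ofReal (min α (α + β)) ^ 2 * ∫⁻ r in Set.Ioo (0 : ℝ) 1, (∫⁻ s in Set.Ioo 0 r, φ s) ^ 2 *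
        ENNReal.ofReal ((1 - r) ^ (2 * α - 1) * (1 - r + a) ^ (2 * β)) ≤
      ∫⁻ s in Set.Ioo (0 : ℝ) 1, φ s ^ 2 *
        ENNReal.ofReal ((1 - s) ^ (2 * α + 1) * (1 - s + a) ^ (2 * β)) := by
  have h := hardy_setLIntegral_le (E := fun t => t ^ α * (t + a) ^ β)
    (E' := fun t => α * t ^ (α - 1) * (t + a) ^ β + t ^ α * (β * (t + a) ^ (β - 1)))
    (m := min α (α + β)) (lt_min hα hαβ) (by fun_prop) ?_ ?_ ?_ ?_ ?_ hφ
  · have hsq : ∀ t : ℝ, 0 < t → (t ^ α * (t + a) ^ β) ^ 2 = t ^ (2 * α) * (t + a) ^ (2 * β) :=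
      fun t ht => by
        rw [mul_pow, ← Real.rpow_mul_natCast ht.le, ← Real.rpow_mul_natCast (by positivity)]
        congr 2 <;> push_cast <;> ring
    convert! h using 1
    · congr 1
      refine setLIntegral_congr_fun measurableSet_Ioo fun r hr => ?_
      have h1 : 0 < 1 - r := sub_pos.2 hr.2
      simp only [hsq _ h1]
      rw [Real.rpow_sub_one h1.ne']
      congr 2
      ring
    · refine setLIntegral_congr_fun measurableSet_Ioo fun s hs => ?_
      have h1 : 0 < 1 - s := sub_pos.2 hs.2
      simp only [hsq _ h1]
      rw [Real.rpow_add_one h1.ne']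
      congr 2
      ring
  · refine ContinuousOn.mul (Real.continuous_rpow_const hα.le).continuousOn ?_
    exact ContinuousOn.rpow_const (by fun_prop) fun t ht => Or.inl (by linarith [ht.1])
  · simp [Real.zero_rpow hα.ne']
  · intro t ht
    have := ht.1
    positivity
  · intro t ht
    have h1 := Real.hasDerivAt_rpow_const (x := t) (p := α) (Or.inl ht.1.ne')
    have h2 := ((hasDerivAt_id t).add_const a).rpow_const (p := β)
      (Or.inl (by simp only [id]; linarith [ht.1]))
    exact (h1.mul h2).congr_deriv (by simp)
  · intro t ht
    have ht0 := ht.1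
    have hta : 0 < t + a := by linarith
    rw [Real.rpow_sub_one ht0.ne', Real.rpow_sub_one hta.ne']
    have h1 : t * (α * (t ^ α / t) * (t + a) ^ β + t ^ α * (β * ((t + a) ^ β / (t + a)))) =
        (α * (t + a) + β * t) / (t + a) * (t ^ α * (t + a) ^ β) := by
      field_simp
    rw [h1]
    gcongr
    rw [le_div_iff₀ hta]
    nlinarith [min_le_left α (α + β), min_le_right α (α + β)]

/-! ### Oscillation about the centre of the disc -/

theorem enorm_sub_le_setLIntegral_ray {g : ℂ → ℂ} (hg : DifferentiableOn ℂ g (ball 0 1)) {r : ℝ}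
    (hr : r ∈ Set.Ioo (0 : ℝ) 1) (θ : ℝ) :
    ‖g (circleMap 0 r θ) - g 0‖ₑ ≤ ∫⁻ s in Set.Ioo 0 r, ‖deriv g (circleMap 0 s θ)‖ₑ := by
  have hmem : ∀ s ∈ Set.uIcc 0 r, circleMap 0 s θ ∈ ball (0 : ℂ) 1 := fun s hs => by
    rw [Set.uIcc_of_le hr.1.le] at hs
    simp only [circleMap_zero, mem_ball, dist_zero_right, norm_mul, Complex.norm_real,
      Complex.norm_exp_ofReal_mul_I, mul_one, Real.norm_eq_abs, abs_of_nonneg hs.1]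
    linarith [hs.2, hr.2]
  have hcirc : ∀ s : ℝ, HasDerivAt (fun s : ℝ => circleMap 0 s θ) (Complex.exp (θ * Complex.I)) s :=
    fun s => by
      simp only [circleMap_zero]
      simpa using (Complex.ofRealCLM.hasDerivAt (x := s)).mul_const (Complex.exp (θ * Complex.I))
  have hd : ∀ s ∈ Set.uIcc 0 r, HasDerivAt (fun s => g (circleMap 0 s θ))
      (deriv g (circleMap 0 s θ) * Complex.exp (θ * Complex.I)) s := fun s hs => by
    have h1 := (hg.differentiableAt (isOpen_ball.mem_nhds (hmem s hs))).hasDerivAt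
    exact HasDerivAt.comp s h1 (hcirc s)
  have hcont : ContinuousOn (fun s => deriv g (circleMap 0 s θ) * Complex.exp (θ * Complex.I))
      (Set.uIcc 0 r) := by
    refine ContinuousOn.mul ?_ continuousOn_const
    exact (hg.deriv isOpen_ball).continuousOn.comp (fun s _ => (hcirc s).continuousAt.continuousWithinAt) hmem
  have h := intervalIntegral.integral_eq_sub_of_hasDerivAt hd hcont.intervalIntegrable
  rw [circleMap_zero_radius, Function.const_apply, intervalIntegral.integral_of_le hr.1.le,
    integral_Ioc_eq_integral_Ioo] at h
  rw [← h]
  refine (enorm_integral_le_lintegral_enorm _).trans (le_of_eq ?_)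
  refine lintegral_congr fun s => ?_
  rw [enorm_mul, ← ofReal_norm (Complex.exp _), Complex.norm_exp_ofReal_mul_I]
  simp

theorem setLIntegral_Ioo_pow (n : ℕ) {R : ℝ} (hR : 0 ≤ R) :
    ∫⁻ r in Set.Ioo 0 R, ENNReal.ofReal (r ^ n) = ENNReal.ofReal (R ^ (n + 1) / (n + 1)) := by
  rw [← ofReal_integral_eq_lintegral_ofReal, ← integral_Ioc_eq_integral_Ioo,
    ← intervalIntegral.integral_of_le hR, integral_pow]
  · simp
  · exact ((continuous_pow n).integrableOn_Icc).mono_set Set.Ioo_subset_Icc_self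
  · exact (ae_restrict_iff' measurableSet_Ioo).2
      (Filter.Eventually.of_forall fun r hr => pow_nonneg hr.1.le n)

theorem enorm_sq_le_setLIntegral_half_ball {h : ℂ → ℂ} (hh : DifferentiableOn ℂ h (ball 0 1))
    {u : ℂ} (hu : ‖u‖ < 1 / 4) :
    ‖h u‖ₑ ^ 2 ≤ 16 * ∫⁻ v in ball (0 : ℂ) (1 / 2), ‖h v‖ₑ ^ 2 := by
  have hsub : ball u (1 / 4) ⊆ ball 0 (1 / 2) := by
    refine ball_subset_ball' ?_
    rw [dist_zero_right]
    linarith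
  have h1 := enorm_sq_mul_le_setLIntegral_ball (k := fun _ => 1)
    (hh.mono (hsub.trans (ball_subset_ball (by norm_num)))) measurable_const
  have h2 := setLIntegral_Ioo_pow 1 (R := 1 / 4) (by norm_num)
  simp only [pow_one] at h2
  simp only [mul_one, h2] at h1
  rw [← ENNReal.ofReal_mul (by positivity)] at h1
  have h3 : 1 ≤ (16 : ℝ≥0∞) *
      ENNReal.ofReal (2 * Real.pi * ((1 / 4) ^ (1 + 1) / ((1 : ℕ) + 1))) := by
    rw [show (16 : ℝ≥0∞) = ENNReal.ofReal 16 by simp, ← ENNReal.ofReal_mul (by norm_num),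
      ENNReal.one_le_ofReal]
    norm_num
    linarith [Real.pi_gt_three]
  calc ‖h u‖ₑ ^ 2 ≤ ‖h u‖ₑ ^ 2 * (16 *
        ENNReal.ofReal (2 * Real.pi * ((1 / 4) ^ (1 + 1) / ((1 : ℕ) + 1)))) :=
        le_mul_of_one_le_right' h3
    _ = 16 * (‖h u‖ₑ ^ 2 *
        ENNReal.ofReal (2 * Real.pi * ((1 / 4) ^ (1 + 1) / ((1 : ℕ) + 1)))) := by ring
    _ ≤ 16 * ∫⁻ v in ball u (1 / 4), ‖h v‖ₑ ^ 2 := by gcongr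
    _ ≤ _ := by gcongr

/-- Along a ray, `‖1 - ρ u‖` is comparable to `(1 - r) + a`, where `a` is its value at the end point
of the ray. -/
theorem norm_one_sub_mul_circleMap_compare {ρ : ℂ} (hρ : ‖ρ‖ < 1) {r : ℝ}
    (hr : r ∈ Set.Ioo (0 : ℝ) 1) (θ : ℝ) :
    0 < ‖1 - ρ * circleMap 0 1 θ‖ ∧ 0 < ‖1 - ρ * circleMap 0 r θ‖ ∧
      ‖1 - ρ * circleMap 0 r θ‖ ≤ 1 - r + ‖1 - ρ * circleMap 0 1 θ‖ ∧
      1 - r + ‖1 - ρ * circleMap 0 1 θ‖ ≤ 3 * ‖1 - ρ * circleMap 0 r θ‖ := by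
  set l := ρ * circleMap 0 1 θ with hl
  have hlr : ρ * circleMap 0 r θ = r * l := by
    simp only [hl, circleMap_zero]
    push_cast
    ring
  have hln : ‖l‖ < 1 := by simpa [hl] using hρ
  have h1 : 1 - ‖l‖ ≤ ‖1 - l‖ := by simpa using norm_sub_norm_le 1 l
  have h2 : ‖(1 - r : ℂ) * l‖ ≤ 1 - r := by
    rw [norm_mul, ← Complex.ofReal_one, ← Complex.ofReal_sub, Complex.norm_real, Real.norm_eq_abs,
      abs_of_pos (sub_pos.2 hr.2)]
    nlinarith [hr.2, norm_nonneg l]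
  have h3 : 1 - r ≤ ‖1 - r * l‖ := by
    have h4 : 1 - ‖(r : ℂ) * l‖ ≤ ‖1 - r * l‖ := by simpa using norm_sub_norm_le 1 ((r : ℂ) * l)
    rw [norm_mul, Complex.norm_real, Real.norm_eq_abs, abs_of_pos hr.1] at h4
    nlinarith [hr.1, norm_nonneg l]
  have h5 : ‖1 - r * l‖ ≤ ‖1 - l‖ + ‖(1 - r : ℂ) * l‖ := by
    refine le_trans (le_of_eq ?_) (norm_add_le _ _)
    congr 1
    ring
  have h6 : ‖1 - l‖ ≤ ‖1 - r * l‖ + ‖(1 - r : ℂ) * l‖ := by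
    refine le_trans (le_of_eq ?_) (norm_sub_le _ _)
    congr 1
    ring
  rw [hlr]
  refine ⟨by linarith, by linarith [hr.2], by linarith, by linarith⟩

/-- The Hardy inequality along a ray for the weights `(1 - |u|²) ^ τ * |1 - ρ u| ^ (σ - τ)`. The
constant depends neither on `ρ` nor on the ray. -/
theorem exists_ray_hardy_bound {σ τ : ℝ} (hσ : -1 < σ) (hτ : -1 < τ) :
    ∃ C : ℝ≥0∞, C ≠ ∞ ∧ ∀ ρ : ℂ, ‖ρ‖ < 1 → ∀ g : ℂ → ℂ, DifferentiableOn ℂ g (ball 0 1) → ∀ θ : ℝ,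
      ∫⁻ r in Set.Ioo (0 : ℝ) 1, ‖g (circleMap 0 r θ) - g 0‖ₑ ^ 2 * ENNReal.ofReal
        ((1 - ‖circleMap 0 r θ‖ ^ 2) ^ τ * ‖1 - ρ * circleMap 0 r θ‖ ^ (σ - τ)) ≤
      C * ∫⁻ r in Set.Ioo (0 : ℝ) 1, ‖deriv g (circleMap 0 r θ)‖ₑ ^ 2 * ENNReal.ofReal
        ((1 - ‖circleMap 0 r θ‖ ^ 2) ^ (2 + τ) * ‖1 - ρ * circleMap 0 r θ‖ ^ (σ - τ)) := by
  set α := (1 + τ) / 2 with hα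
  set β := (σ - τ) / 2 with hβ
  have hα0 : 0 < α := by rw [hα]; linarith
  have hαβ : 0 < α + β := by rw [hα, hβ]; linarith
  have hm : 0 < min α (α + β) := lt_min hα0 hαβ
  refine ⟨ENNReal.ofReal (2 ^ |τ| * 3 ^ |σ - τ|) * ((ENNReal.ofReal (min α (α + β)) ^ 2)⁻¹ *
    ENNReal.ofReal (2 ^ |2 + τ| * 3 ^ |σ - τ|)), ?_, fun ρ hρ g hg θ => ?_⟩
  · refine ENNReal.mul_ne_top ENNReal.ofReal_ne_top (ENNReal.mul_ne_top ?_ ENNReal.ofReal_ne_top)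
    simpa using hm
  set a := ‖1 - ρ * circleMap 0 1 θ‖ with ha
  have ha0 : 0 < a := (norm_one_sub_mul_circleMap_compare hρ (r := 1 / 2) (by norm_num) θ).1
  have hnorm : ∀ r ∈ Set.Ioo (0 : ℝ) 1, ‖circleMap 0 r θ‖ = r := fun r hr => by
    simp [abs_of_pos hr.1]
  have hφ : Measurable fun s => ‖deriv g (circleMap 0 s θ)‖ₑ :=
    ((measurable_deriv g).comp (by unfold circleMap; fun_prop : Measurable fun s =>
      circleMap 0 s θ)).enorm
  have hH := hardy_rpow_setLIntegral_le hα0 hαβ ha0 hφ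
  rw [show 2 * α - 1 = τ by rw [hα]; ring, show 2 * α + 1 = 2 + τ by rw [hα]; ring,
    show 2 * β = σ - τ by rw [hβ]; ring] at hH
  have hW : ∀ r ∈ Set.Ioo (0 : ℝ) 1,
      (1 - ‖circleMap 0 r θ‖ ^ 2) ^ τ * ‖1 - ρ * circleMap 0 r θ‖ ^ (σ - τ) ≤
        2 ^ |τ| * 3 ^ |σ - τ| * ((1 - r) ^ τ * (1 - r + a) ^ (σ - τ)) := fun r hr => by
    obtain ⟨-, h1, h2, h3⟩ := norm_one_sub_mul_circleMap_compare hρ hr θ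
    have hr1 := sub_pos.2 hr.2
    rw [hnorm r hr, mul_mul_mul_comm]
    refine mul_le_mul (Real.rpow_le_rpow_abs_mul_rpow _ ?_ ?_ ?_ ?_ ?_)
      (Real.rpow_le_rpow_abs_mul_rpow _ h1 (by positivity) (by norm_num) (by linarith) h3)
      (by positivity) (by positivity) <;> nlinarith [hr.1]
  have hV : ∀ r ∈ Set.Ioo (0 : ℝ) 1, (1 - r) ^ (2 + τ) * (1 - r + a) ^ (σ - τ) ≤
      2 ^ |2 + τ| * 3 ^ |σ - τ| *
      ((1 - ‖circleMap 0 r θ‖ ^ 2) ^ (2 + τ) * ‖1 - ρ * circleMap 0 r θ‖ ^ (σ - τ)) := fun r hr => by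
    obtain ⟨-, h1, h2, h3⟩ := norm_one_sub_mul_circleMap_compare hρ hr θ
    have hr1 := sub_pos.2 hr.2
    rw [hnorm r hr, mul_mul_mul_comm]
    have hr2 : 0 < 1 - r ^ 2 := by nlinarith [hr.1]
    refine mul_le_mul (Real.rpow_le_rpow_abs_mul_rpow _ ?_ ?_ ?_ ?_ ?_)
      (Real.rpow_le_rpow_abs_mul_rpow _ (by positivity) h1 (by norm_num) h3 (by linarith))
      (by positivity) (by positivity) <;> nlinarith [hr.1]
  calc _ ≤ ∫⁻ r in Set.Ioo (0 : ℝ) 1, ENNReal.ofReal (2 ^ |τ| * 3 ^ |σ - τ|) *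
        ((∫⁻ s in Set.Ioo 0 r, ‖deriv g (circleMap 0 s θ)‖ₑ) ^ 2 *
          ENNReal.ofReal ((1 - r) ^ τ * (1 - r + a) ^ (σ - τ))) := by
        refine setLIntegral_mono' measurableSet_Ioo fun r hr => ?_
        rw [mul_left_comm, ← ENNReal.ofReal_mul (by positivity)]
        exact mul_le_mul' (pow_le_pow_left' (enorm_sub_le_setLIntegral_ray hg hr θ) 2)
          (ENNReal.ofReal_le_ofReal (hW r hr))
    _ ≤ ENNReal.ofReal (2 ^ |τ| * 3 ^ |σ - τ|) * ((ENNReal.ofReal (min α (α + β)) ^ 2)⁻¹ *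
        ∫⁻ s in Set.Ioo (0 : ℝ) 1, ‖deriv g (circleMap 0 s θ)‖ₑ ^ 2 *
          ENNReal.ofReal ((1 - s) ^ (2 + τ) * (1 - s + a) ^ (σ - τ))) := by
        rw [lintegral_const_mul' _ _ ENNReal.ofReal_ne_top]
        gcongr
        rw [← ENNReal.div_eq_inv_mul, ENNReal.le_div_iff_mul_le (Or.inl (by simpa using hm))
          (Or.inl (by simp)), mul_comm]
        exact hH
    _ ≤ ENNReal.ofReal (2 ^ |τ| * 3 ^ |σ - τ|) * ((ENNReal.ofReal (min α (α + β)) ^ 2)⁻¹ *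
        ∫⁻ s in Set.Ioo (0 : ℝ) 1, ENNReal.ofReal (2 ^ |2 + τ| * 3 ^ |σ - τ|) *
          (‖deriv g (circleMap 0 s θ)‖ₑ ^ 2 * ENNReal.ofReal
        ((1 - ‖circleMap 0 s θ‖ ^ 2) ^ (2 + τ) * ‖1 - ρ * circleMap 0 s θ‖ ^ (σ - τ)))) := by
        gcongr _ * (_ * ?_)
        refine setLIntegral_mono' measurableSet_Ioo fun s hs => ?_
        rw [mul_left_comm, ← ENNReal.ofReal_mul (by positivity)]
        exact mul_le_mul_right (ENNReal.ofReal_le_ofReal (hV s hs)) _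
    _ = _ := by
        rw [lintegral_const_mul' _ _ ENNReal.ofReal_ne_top]
        ring

/-- Hardy's inequality on the disc: the oscillation of an analytic function from its value at the
centre is controlled by its derivative, uniformly in the weight parameter `ρ`. -/
theorem exists_disc_hardy_bound {σ τ : ℝ} (hσ : -1 < σ) (hτ : -1 < τ) :
    ∃ C : ℝ≥0∞, C ≠ ∞ ∧ ∀ ρ : ℂ, ‖ρ‖ < 1 → ∀ g : ℂ → ℂ, Measurable g →
      DifferentiableOn ℂ g (ball 0 1) →
      ∫⁻ u in ball (0 : ℂ) 1, ‖g u - g 0‖ₑ ^ 2 * ENNReal.ofReal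
        ((1 - ‖u‖ ^ 2) ^ τ * ‖1 - ρ * u‖ ^ (σ - τ)) ≤
      C * ∫⁻ u in ball (0 : ℂ) 1, ‖deriv g u‖ₑ ^ 2 * ENNReal.ofReal
        ((1 - ‖u‖ ^ 2) ^ (2 + τ) * ‖1 - ρ * u‖ ^ (σ - τ)) := by
  obtain ⟨C, hC, hray⟩ := exists_ray_hardy_bound hσ hτ
  set c := σ - τ with hc
  refine ⟨C * (ENNReal.ofReal (2 * Real.pi) * (16 * ENNReal.ofReal (2 ^ |2 + τ| * 2 ^ |c|) *
    ENNReal.ofReal (2 ^ |c|)) + 4), ?_, fun ρ hρ g hgm hg => ?_⟩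
  · refine ENNReal.mul_ne_top hC (ENNReal.add_ne_top.2 ⟨?_, by simp⟩)
    refine ENNReal.mul_ne_top ENNReal.ofReal_ne_top (ENNReal.mul_ne_top
      (ENNReal.mul_ne_top (by simp) ENNReal.ofReal_ne_top) ENNReal.ofReal_ne_top)
  set V : ℂ → ℝ≥0∞ := fun u => ENNReal.ofReal ((1 - ‖u‖ ^ 2) ^ (2 + τ) * ‖1 - ρ * u‖ ^ c) with hV
  have hVm : Measurable V := by fun_prop
  have hgd := measurable_deriv g
  have hcm := measurable_circleMap_prod 0
  set I := ∫⁻ u in ball (0 : ℂ) 1, ‖deriv g u‖ₑ ^ 2 * V u with hI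
  have hq : ∀ u : ℂ, ‖u‖ < 1 / 2 → 1 / 2 ≤ ‖1 - ρ * u‖ ∧ ‖1 - ρ * u‖ ≤ 2 := fun u hu => by
    have h1 : ‖ρ * u‖ ≤ 1 / 2 := by
      rw [norm_mul]
      nlinarith [norm_nonneg u, norm_nonneg ρ]
    have h2 : 1 - ‖ρ * u‖ ≤ ‖1 - ρ * u‖ := by simpa using norm_sub_norm_le 1 (ρ * u)
    have h3 : ‖1 - ρ * u‖ ≤ 1 + ‖ρ * u‖ := by simpa using norm_sub_le 1 (ρ * u)
    constructor <;> linarith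
  -- `V` is bounded above and below near the origin.
  have hVle : ∀ u : ℂ, ‖u‖ < 1 / 2 → V u ≤ ENNReal.ofReal (2 ^ |c|) := fun u hu => by
    obtain ⟨h1, h2⟩ := hq u hu
    have hu2 : ‖u‖ ^ 2 ≤ 1 / 2 := by nlinarith [norm_nonneg u]
    refine ENNReal.ofReal_le_ofReal ?_
    have h3 := Real.rpow_le_rpow_abs_mul_rpow (x := ‖1 - ρ * u‖) (y := 1) (K := 2) c (by linarith)
      one_pos (by norm_num) (by linarith) (by linarith)
    rw [Real.one_rpow, mul_one] at h3
    calc _ ≤ (1 : ℝ) * 2 ^ |c| := by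
          gcongr
          exact Real.rpow_le_one (by linarith) (by nlinarith [norm_nonneg u]) (by linarith)
      _ = _ := one_mul _
  have hVge : ∀ u : ℂ, ‖u‖ < 1 / 2 → 1 ≤ ENNReal.ofReal (2 ^ |2 + τ| * 2 ^ |c|) * V u :=
    fun u hu => by
    obtain ⟨h1, h2⟩ := hq u hu
    have hu2 : ‖u‖ ^ 2 ≤ 1 / 2 := by nlinarith [norm_nonneg u]
    have h3 := Real.rpow_le_rpow_abs_mul_rpow (x := 1) (y := ‖1 - ρ * u‖) (K := 2) c one_pos
      (by linarith) (by norm_num) (by linarith) (by linarith)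
    have h4 := Real.rpow_le_rpow_abs_mul_rpow (x := 1) (y := 1 - ‖u‖ ^ 2) (K := 2) (2 + τ) one_pos
      (by linarith) (by norm_num) (by linarith) (by nlinarith [norm_nonneg u])
    rw [Real.one_rpow] at h3 h4
    rw [hV, ← ENNReal.ofReal_mul (by positivity), ENNReal.one_le_ofReal, mul_mul_mul_comm]
    exact one_le_mul_of_one_le_of_one_le h4 h3
  have hsup : ∀ u : ℂ, ‖u‖ < 1 / 4 →
      ‖deriv g u‖ₑ ^ 2 * V u ≤ 16 * ENNReal.ofReal (2 ^ |2 + τ| * 2 ^ |c|) *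
        ENNReal.ofReal (2 ^ |c|) * I := fun u hu => by
    calc ‖deriv g u‖ₑ ^ 2 * V u
        ≤ (16 * ∫⁻ v in ball (0 : ℂ) (1 / 2), ‖deriv g v‖ₑ ^ 2) * ENNReal.ofReal (2 ^ |c|) := by
          gcongr
          · exact enorm_sq_le_setLIntegral_half_ball (hg.deriv isOpen_ball) hu
          · exact hVle u (by linarith)
      _ ≤ (16 * ∫⁻ v in ball (0 : ℂ) (1 / 2), ENNReal.ofReal (2 ^ |2 + τ| * 2 ^ |c|) *
            (‖deriv g v‖ₑ ^ 2 * V v)) * ENNReal.ofReal (2 ^ |c|) := by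
          gcongr _ * ?_ * _
          refine setLIntegral_mono' measurableSet_ball fun v hv => ?_
          rw [mul_left_comm]
          exact le_mul_of_one_le_right' (hVge v (by simpa using hv))
      _ ≤ (16 * ∫⁻ v in ball (0 : ℂ) 1, ENNReal.ofReal (2 ^ |2 + τ| * 2 ^ |c|) *
            (‖deriv g v‖ₑ ^ 2 * V v)) * ENNReal.ofReal (2 ^ |c|) := by
          gcongr
          norm_num
      _ = _ := by
          rw [lintegral_const_mul' _ _ ENNReal.ofReal_ne_top]
          ring
  calc _ = ∫⁻ r in Set.Ioo (0 : ℝ) 1, ENNReal.ofReal r * ∫⁻ θ in Set.Ioo (-Real.pi) Real.pi,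
        ‖g (circleMap 0 r θ) - g 0‖ₑ ^ 2 * ENNReal.ofReal
        ((1 - ‖circleMap 0 r θ‖ ^ 2) ^ τ * ‖1 - ρ * circleMap 0 r θ‖ ^ c) :=
        setLIntegral_ball_eq_polar (by fun_prop) 0 1
    _ ≤ ∫⁻ r in Set.Ioo (0 : ℝ) 1, ∫⁻ θ in Set.Ioo (-Real.pi) Real.pi,
        ‖g (circleMap 0 r θ) - g 0‖ₑ ^ 2 * ENNReal.ofReal
        ((1 - ‖circleMap 0 r θ‖ ^ 2) ^ τ * ‖1 - ρ * circleMap 0 r θ‖ ^ c) := by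
        refine setLIntegral_mono' measurableSet_Ioo fun r hr => ?_
        exact mul_le_of_le_one_left' (ENNReal.ofReal_le_one.2 hr.2.le)
    _ = ∫⁻ θ in Set.Ioo (-Real.pi) Real.pi, ∫⁻ r in Set.Ioo (0 : ℝ) 1,
        ‖g (circleMap 0 r θ) - g 0‖ₑ ^ 2 * ENNReal.ofReal
        ((1 - ‖circleMap 0 r θ‖ ^ 2) ^ τ * ‖1 - ρ * circleMap 0 r θ‖ ^ c) := by
        refine lintegral_lintegral_swap (Measurable.aemeasurable ?_)
        exact (by fun_prop : Measurable fun u => ‖g u - g 0‖ₑ ^ 2 * ENNReal.ofReal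
          ((1 - ‖u‖ ^ 2) ^ τ * ‖1 - ρ * u‖ ^ c)).comp hcm
    _ ≤ ∫⁻ θ in Set.Ioo (-Real.pi) Real.pi, C * ∫⁻ r in Set.Ioo (0 : ℝ) 1,
        ‖deriv g (circleMap 0 r θ)‖ₑ ^ 2 * V (circleMap 0 r θ) :=
        lintegral_mono fun θ => hray ρ hρ g hg θ
    _ = C * ∫⁻ r in Set.Ioo (0 : ℝ) 1, ∫⁻ θ in Set.Ioo (-Real.pi) Real.pi,
        ‖deriv g (circleMap 0 r θ)‖ₑ ^ 2 * V (circleMap 0 r θ) := by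
        rw [lintegral_const_mul' _ _ hC, lintegral_lintegral_swap]
        exact ((by fun_prop : Measurable fun u => ‖deriv g u‖ₑ ^ 2 * V u).comp
          (hcm.comp measurable_swap)).aemeasurable
    _ ≤ C * ∫⁻ r in Set.Ioo (0 : ℝ) 1, (ENNReal.ofReal (2 * Real.pi) *
        (16 * ENNReal.ofReal (2 ^ |2 + τ| * 2 ^ |c|) * ENNReal.ofReal (2 ^ |c|) * I) +
        4 * (ENNReal.ofReal r * ∫⁻ θ in Set.Ioo (-Real.pi) Real.pi,
          ‖deriv g (circleMap 0 r θ)‖ₑ ^ 2 * V (circleMap 0 r θ))) := by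
        refine mul_le_mul_right (setLIntegral_mono' measurableSet_Ioo fun r hr => ?_) _
        -- The polar density `r` degenerates at the origin, where the supremum bound is used instead.
        rcases lt_or_ge r (1 / 4) with h | h
        · refine le_add_right ?_
          calc _ ≤ ∫⁻ θ in Set.Ioo (-Real.pi) Real.pi, 16 *
                ENNReal.ofReal (2 ^ |2 + τ| * 2 ^ |c|) * ENNReal.ofReal (2 ^ |c|) * I :=
                lintegral_mono fun θ => hsup _ (by simpa [abs_of_pos hr.1] using h)
            _ = _ := by
                rw [lintegral_const, Measure.restrict_apply_univ, Real.volume_Ioo, mul_comm]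
                congr 2
                ring
        · refine le_add_left ?_
          rw [← mul_assoc]
          refine le_mul_of_one_le_left' ?_
          rw [show (4 : ℝ≥0∞) = ENNReal.ofReal 4 by simp, ← ENNReal.ofReal_mul (by norm_num),
            ENNReal.one_le_ofReal]
          linarith
    _ = C * (ENNReal.ofReal (2 * Real.pi) *
        (16 * ENNReal.ofReal (2 ^ |2 + τ| * 2 ^ |c|) * ENNReal.ofReal (2 ^ |c|) * I) + 4 * I) := by
        rw [lintegral_add_left measurable_const, lintegral_const_mul' (4 : ℝ≥0∞) _ (by simp),
          ← setLIntegral_ball_eq_polar (F := fun u => ‖deriv g u‖ₑ ^ 2 * V u) (by fun_prop) 0 1]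
        simp [hI]
    _ = _ := by ring

/-! ### Transport by disc automorphisms -/

/-- The involutive automorphism of the unit disc that interchanges `0` and `z`. -/
noncomputable def discInvolution (z u : ℂ) : ℂ :=
  (z - u) / (1 - (starRingEnd ℂ) z * u)

theorem one_sub_conj_mul_ne_zero {z u : ℂ} (hz : ‖z‖ ≤ 1) (hu : ‖u‖ < 1) :
    1 - (starRingEnd ℂ) z * u ≠ 0 := fun h => by
  have h1 : ‖(starRingEnd ℂ) z * u‖ < 1 := by
    rw [norm_mul, RCLike.norm_conj]
    nlinarith [norm_nonneg z, norm_nonneg u]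
  rw [← sub_eq_zero.1 h] at h1
  simp at h1

theorem norm_one_sub_conj_mul_pos {z u : ℂ} (hz : ‖z‖ ≤ 1) (hu : ‖u‖ < 1) :
    0 < ‖1 - (starRingEnd ℂ) z * u‖ :=
  norm_pos_iff.2 (one_sub_conj_mul_ne_zero hz hu)

theorem norm_one_sub_conj_mul_sq (z u : ℂ) :
    ‖1 - (starRingEnd ℂ) z * u‖ ^ 2 = ‖z - u‖ ^ 2 + (1 - ‖z‖ ^ 2) * (1 - ‖u‖ ^ 2) := by
  simp only [← Complex.normSq_eq_norm_sq, Complex.normSq_apply]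
  simp
  ring

theorem one_sub_norm_sq_discInvolution {z u : ℂ} (hz : ‖z‖ < 1) (hu : ‖u‖ < 1) :
    1 - ‖discInvolution z u‖ ^ 2 =
      (1 - ‖z‖ ^ 2) * (1 - ‖u‖ ^ 2) / ‖1 - (starRingEnd ℂ) z * u‖ ^ 2 := by
  have h := norm_one_sub_conj_mul_pos hz.le hu
  rw [discInvolution, norm_div, div_pow, eq_div_iff (by positivity), sub_mul,
    div_mul_cancel₀ _ (by positivity), one_mul, norm_one_sub_conj_mul_sq]
  ring

theorem norm_discInvolution_lt_one {z u : ℂ} (hz : ‖z‖ < 1) (hu : ‖u‖ < 1) :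
    ‖discInvolution z u‖ < 1 := by
  have h := norm_one_sub_conj_mul_pos hz.le hu
  have h1 := one_sub_norm_sq_discInvolution hz hu
  have h2 : 0 < (1 - ‖z‖ ^ 2) * (1 - ‖u‖ ^ 2) / ‖1 - (starRingEnd ℂ) z * u‖ ^ 2 := by
    have : 0 < 1 - ‖z‖ ^ 2 := by nlinarith [norm_nonneg z]
    have : 0 < 1 - ‖u‖ ^ 2 := by nlinarith [norm_nonneg u]
    positivity
  nlinarith [norm_nonneg (discInvolution z u)]

theorem one_sub_conj_mul_discInvolution {z u : ℂ} (hz : ‖z‖ < 1) (hu : ‖u‖ < 1) :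
    1 - (starRingEnd ℂ) z * discInvolution z u =
      ((1 - ‖z‖ ^ 2 : ℝ) : ℂ) / (1 - (starRingEnd ℂ) z * u) := by
  have h := one_sub_conj_mul_ne_zero hz.le hu
  rw [discInvolution, eq_div_iff h, sub_mul, mul_assoc, div_mul_cancel₀ _ h]
  push_cast
  rw [← Complex.conj_mul' z]
  ring

theorem discInvolution_discInvolution {z u : ℂ} (hz : ‖z‖ < 1) (hu : ‖u‖ < 1) :
    discInvolution z (discInvolution z u) = u := by
  have h := one_sub_conj_mul_ne_zero hz.le hu
  have h1 := one_sub_conj_mul_discInvolution hz hu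
  have hz0 : ((1 - ‖z‖ ^ 2 : ℝ) : ℂ) ≠ 0 := by
    norm_cast
    nlinarith [norm_nonneg z]
  rw [discInvolution, h1, div_eq_iff (div_ne_zero hz0 h), discInvolution]
  push_cast
  rw [← Complex.conj_mul' z, mul_div_assoc', eq_div_iff h, sub_mul, div_mul_cancel₀ _ h]
  ring

theorem hasDerivAt_discInvolution {z u : ℂ} (hz : ‖z‖ < 1) (hu : ‖u‖ < 1) :
    HasDerivAt (discInvolution z)
      (-((1 - ‖z‖ ^ 2 : ℝ) : ℂ) / (1 - (starRingEnd ℂ) z * u) ^ 2) u := by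
  have h := one_sub_conj_mul_ne_zero hz.le hu
  have h1 := ((hasDerivAt_id u).const_sub z).div
    (((hasDerivAt_id u).const_mul ((starRingEnd ℂ) z)).const_sub 1) h
  refine h1.congr_deriv ?_
  push_cast
  rw [← Complex.conj_mul' z]
  simp only [id]
  ring

theorem image_discInvolution_ball {z : ℂ} (hz : ‖z‖ < 1) :
    discInvolution z '' ball 0 1 = ball 0 1 := by
  ext w
  simp only [Set.mem_image, mem_ball_zero_iff]
  constructor
  · rintro ⟨u, hu, rfl⟩
    exact norm_discInvolution_lt_one hz hu
  · exact fun hw => ⟨discInvolution z w, norm_discInvolution_lt_one hz hw,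
      discInvolution_discInvolution hz hw⟩

theorem measurable_discInvolution (z : ℂ) : Measurable (discInvolution z) := by
  unfold discInvolution
  fun_prop

theorem abs_det_toSpanSingleton_restrictScalars (a : ℂ) :
    |((ContinuousLinearMap.toSpanSingleton ℂ a).restrictScalars ℝ : ℂ →L[ℝ] ℂ).det| = ‖a‖ ^ 2 := by
  have h : ((ContinuousLinearMap.toSpanSingleton ℂ a).restrictScalars ℝ : ℂ →L[ℝ] ℂ).det =
      Algebra.norm ℝ a := by
    rw [Algebra.norm_apply, ContinuousLinearMap.det]
    congr 1
    ext x
    simp [mul_comm]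
  rw [h, Algebra.norm_complex_apply, Complex.normSq_eq_norm_sq, abs_of_nonneg (by positivity)]

/-- Change of variables under the disc involution. -/
theorem setLIntegral_ball_comp_discInvolution {z : ℂ} (hz : ‖z‖ < 1) (G : ℂ → ℝ≥0∞) :
    ∫⁻ w in ball (0 : ℂ) 1, G w = ∫⁻ u in ball (0 : ℂ) 1,
      ENNReal.ofReal (((1 - ‖z‖ ^ 2) / ‖1 - (starRingEnd ℂ) z * u‖ ^ 2) ^ 2) *
        G (discInvolution z u) := by
  have hinj : Set.InjOn (discInvolution z) (ball 0 1) := fun u hu v hv h => by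
    rw [mem_ball_zero_iff] at hu hv
    rw [← discInvolution_discInvolution hz hu, h, discInvolution_discInvolution hz hv]
  have h := lintegral_image_eq_lintegral_abs_det_fderiv_mul volume measurableSet_ball
    (fun u hu => ((hasDerivAt_discInvolution hz (mem_ball_zero_iff.1 hu)).hasFDerivAt.restrictScalars
      ℝ).hasFDerivWithinAt) hinj G
  rw [image_discInvolution_ball hz] at h
  rw [h]
  refine setLIntegral_congr_fun measurableSet_ball fun u hu => ?_
  have hz2 : 0 < 1 - ‖z‖ ^ 2 := by nlinarith [norm_nonneg z]
  rw [abs_det_toSpanSingleton_restrictScalars, norm_div, norm_neg, norm_pow, Complex.norm_real,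
    Real.norm_eq_abs, abs_of_pos hz2]

/-- For fixed `z`, the weighted oscillation of `f` about `f z` is controlled by the derivative: the
Hardy inequality on the disc transported by the involution that moves the centre to `z`. -/
theorem exists_oscillation_le_deriv_bound {σ τ : ℝ} (hσ : -1 < σ) (hτ : -1 < τ) :
    ∃ C : ℝ≥0∞, C ≠ ∞ ∧ ∀ f : ℂ → ℂ, Measurable f → DifferentiableOn ℂ f (ball 0 1) →
      ∀ z : ℂ, ‖z‖ < 1 →
      ∫⁻ w in ball (0 : ℂ) 1, ‖f z - f w‖ₑ ^ 2 * ENNReal.ofReal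
        ((1 - ‖w‖ ^ 2) ^ τ / ‖1 - (starRingEnd ℂ) z * w‖ ^ (4 + σ + τ)) ≤
      C * ∫⁻ w in ball (0 : ℂ) 1, ‖deriv f w‖ₑ ^ 2 * ENNReal.ofReal
        ((1 - ‖w‖ ^ 2) ^ (2 + τ) / ‖1 - (starRingEnd ℂ) z * w‖ ^ (4 + σ + τ)) := by
  obtain ⟨C, hC, H⟩ := exists_disc_hardy_bound hσ hτ
  refine ⟨C, hC, fun f hfm hf z hz => ?_⟩
  have hz2 : 0 < 1 - ‖z‖ ^ 2 := by nlinarith [norm_nonneg z]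
  set g := fun u => f (discInvolution z u) with hg
  have hmem : ∀ u ∈ ball (0 : ℂ) 1, discInvolution z u ∈ ball (0 : ℂ) 1 := fun u hu => by
    rw [mem_ball_zero_iff] at hu ⊢
    exact norm_discInvolution_lt_one hz hu
  have hgd : ∀ u ∈ ball (0 : ℂ) 1, HasDerivAt g (deriv f (discInvolution z u) *
      (-((1 - ‖z‖ ^ 2 : ℝ) : ℂ) / (1 - (starRingEnd ℂ) z * u) ^ 2)) u := fun u hu =>
    (hf.differentiableAt (isOpen_ball.mem_nhds (hmem u hu))).hasDerivAt.comp u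
      (hasDerivAt_discInvolution hz (mem_ball_zero_iff.1 hu))
  have hg0 : g 0 = f z := by simp [hg, discInvolution]
  have h := H ((starRingEnd ℂ) z) (by rwa [RCLike.norm_conj]) g
    (hfm.comp (measurable_discInvolution z))
    (fun u hu => (hgd u hu).differentiableAt.differentiableWithinAt)
  -- Both integrands pick up the same power of `1 - |z|²` under the change of variables.
  have hpow : ∀ p : ℝ, ∀ u : ℂ, ‖u‖ < 1 →
      (1 - ‖discInvolution z u‖ ^ 2) ^ p /
        ‖1 - (starRingEnd ℂ) z * discInvolution z u‖ ^ (4 + σ + τ) =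
      (1 - ‖z‖ ^ 2) ^ (p - (4 + σ + τ)) *
        ((1 - ‖u‖ ^ 2) ^ p * ‖1 - (starRingEnd ℂ) z * u‖ ^ (4 + σ + τ - 2 * p)) :=
    fun p u hu => by
    have hu2 : 0 < 1 - ‖u‖ ^ 2 := by nlinarith [norm_nonneg u]
    have hq := norm_one_sub_conj_mul_pos hz.le hu
    rw [one_sub_norm_sq_discInvolution hz hu, one_sub_conj_mul_discInvolution hz hu, norm_div,
      Complex.norm_real, Real.norm_eq_abs, abs_of_pos hz2, Real.div_rpow (by positivity)
      (by positivity), Real.div_rpow hz2.le hq.le, Real.mul_rpow hz2.le hu2.le, Real.rpow_sub hz2,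
      Real.rpow_sub hq, Real.rpow_mul hq.le, Real.rpow_two]
    field_simp
  have hleft : ∫⁻ w in ball (0 : ℂ) 1, ‖f z - f w‖ₑ ^ 2 * ENNReal.ofReal
        ((1 - ‖w‖ ^ 2) ^ τ / ‖1 - (starRingEnd ℂ) z * w‖ ^ (4 + σ + τ)) =
      ENNReal.ofReal ((1 - ‖z‖ ^ 2) ^ (-2 - σ)) * ∫⁻ u in ball (0 : ℂ) 1, ‖g u - g 0‖ₑ ^ 2 *
        ENNReal.ofReal ((1 - ‖u‖ ^ 2) ^ τ * ‖1 - (starRingEnd ℂ) z * u‖ ^ (σ - τ)) := by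
    rw [setLIntegral_ball_comp_discInvolution hz, ← lintegral_const_mul' _ _ ENNReal.ofReal_ne_top]
    refine setLIntegral_congr_fun measurableSet_ball fun u hu => ?_
    rw [mem_ball_zero_iff] at hu
    have hu2 : 0 < 1 - ‖u‖ ^ 2 := by nlinarith [norm_nonneg u]
    have hq := norm_one_sub_conj_mul_pos hz.le hu
    rw [hpow τ u hu, hg0, ← enorm_neg (g u - f z), neg_sub, mul_left_comm,
      ← ENNReal.ofReal_mul (by positivity),
      mul_left_comm (ENNReal.ofReal ((1 - ‖z‖ ^ 2) ^ (-2 - σ))), ← ENNReal.ofReal_mul (by positivity)]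
    congr 2
    have e1 : (1 - ‖z‖ ^ 2) ^ (-2 - σ) = (1 - ‖z‖ ^ 2) ^ 2 * (1 - ‖z‖ ^ 2) ^ (τ - (4 + σ + τ)) := by
      rw [← Real.rpow_natCast (1 - ‖z‖ ^ 2) 2, ← Real.rpow_add hz2]
      congr 1
      push_cast
      ring
    have e2 : ‖1 - (starRingEnd ℂ) z * u‖ ^ (4 + σ + τ - 2 * τ) =
        ‖1 - (starRingEnd ℂ) z * u‖ ^ 4 * ‖1 - (starRingEnd ℂ) z * u‖ ^ (σ - τ) := by
      rw [← Real.rpow_natCast, ← Real.rpow_add hq]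
      congr 1
      push_cast
      ring
    rw [e1, e2]
    field_simp
  have hright : ∫⁻ w in ball (0 : ℂ) 1, ‖deriv f w‖ₑ ^ 2 * ENNReal.ofReal
        ((1 - ‖w‖ ^ 2) ^ (2 + τ) / ‖1 - (starRingEnd ℂ) z * w‖ ^ (4 + σ + τ)) =
      ENNReal.ofReal ((1 - ‖z‖ ^ 2) ^ (-2 - σ)) * ∫⁻ u in ball (0 : ℂ) 1, ‖deriv g u‖ₑ ^ 2 *
        ENNReal.ofReal ((1 - ‖u‖ ^ 2) ^ (2 + τ) * ‖1 - (starRingEnd ℂ) z * u‖ ^ (σ - τ)) := by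
    rw [setLIntegral_ball_comp_discInvolution hz, ← lintegral_const_mul' _ _ ENNReal.ofReal_ne_top]
    refine setLIntegral_congr_fun measurableSet_ball fun u hu => ?_
    have hd := (hgd u hu).deriv
    rw [mem_ball_zero_iff] at hu
    have hu2 : 0 < 1 - ‖u‖ ^ 2 := by nlinarith [norm_nonneg u]
    have e3 : ‖deriv g u‖ₑ ^ 2 = ‖deriv f (discInvolution z u)‖ₑ ^ 2 *
        ENNReal.ofReal (((1 - ‖z‖ ^ 2) / ‖1 - (starRingEnd ℂ) z * u‖ ^ 2) ^ 2) := by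
      rw [hd, enorm_mul, mul_pow, ← ofReal_norm (_ / _), ← ENNReal.ofReal_pow (by positivity),
        norm_div, norm_neg, norm_pow, Complex.norm_real, Real.norm_eq_abs, abs_of_pos hz2]
    rw [hpow (2 + τ) u hu, e3, show 2 + τ - (4 + σ + τ) = -2 - σ by ring,
      show 4 + σ + τ - 2 * (2 + τ) = σ - τ by ring, ENNReal.ofReal_mul (by positivity)]
    ring
  rw [hleft, hright, mul_left_comm]
  gcongr

/-! ### Area integrals of the Poisson kernel -/

/-- The radial integral that arises from an area integral with a pole at distance `d` from the
boundary. -/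
theorem setLIntegral_rpow_mul_rpow_le {a e d : ℝ} (ha : 0 < a) (he : 0 < e) (hd : 0 < d) :
    ENNReal.ofReal (min a e) * ∫⁻ r in Set.Ioo (0 : ℝ) 1,
        ENNReal.ofReal ((1 - r) ^ (a - 1) * (1 - r + d) ^ (-(a + e))) ≤
      ENNReal.ofReal (3 * d ^ (-e)) := by
  -- `t ^ a * (t + d) ^ (-(a + e)) - 2 * (t + d) ^ (-e)`, with `t = 1 - r`, has derivative in `t` at
  -- least `min a e` times the integrand.
  refine (setLIntegral_Ioo_le_of_hasDerivAt
    (F := fun r => 2 * (1 - r + d) ^ (-e) - (1 - r) ^ a * (1 - r + d) ^ (-(a + e)))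
    (F' := fun r => 2 * (e * (1 - r + d) ^ (-e - 1)) + (a * (1 - r) ^ (a - 1) *
      (1 - r + d) ^ (-(a + e)) - (1 - r) ^ a * ((a + e) * (1 - r + d) ^ (-(a + e) - 1))))
    zero_le_one ?_ ?_ (le_min ha.le he.le) ?_ ?_).trans ?_
  · have h1 : ∀ p : ℝ, ContinuousOn (fun r : ℝ => (1 - r + d) ^ p) (Set.Icc 0 1) := fun p =>
      ContinuousOn.rpow_const (by fun_prop) fun r hr => Or.inl (by linarith [hr.2])
    have h2 : ContinuousOn (fun r : ℝ => (1 - r) ^ a) (Set.Icc 0 1) :=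
      ContinuousOn.rpow_const (by fun_prop) fun r hr => Or.inr ha.le
    exact (continuousOn_const.mul (h1 _)).sub (h2.mul (h1 _))
  · intro r hr
    have ht : 0 < 1 - r := sub_pos.2 hr.2
    have h0 : HasDerivAt (fun r : ℝ => 1 - r) (-1) r := by
      simpa using (hasDerivAt_id r).const_sub 1
    have h1 : ∀ p : ℝ, HasDerivAt (fun r : ℝ => (1 - r + d) ^ p)
        (-1 * p * (1 - r + d) ^ (p - 1)) r := fun p =>
      (h0.add_const d).rpow_const (Or.inl (by linarith))
    have h2 : HasDerivAt (fun r : ℝ => (1 - r) ^ a) (-1 * a * (1 - r) ^ (a - 1)) r :=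
      h0.rpow_const (Or.inl ht.ne')
    exact (((h1 (-e)).const_mul 2).sub (h2.mul (h1 (-(a + e))))).congr_deriv (by ring)
  · intro r hr
    have ht : 0 < 1 - r := sub_pos.2 hr.2
    positivity
  · intro r hr
    have ht : 0 < 1 - r := sub_pos.2 hr.2
    set t := 1 - r with htdef
    have hs : 0 < t + d := by linarith
    have e1 : (t + d) ^ (-e - 1) = (t + d) ^ a * (t + d) ^ (-(a + e)) / (t + d) := by
      rw [← Real.rpow_add hs, Real.rpow_sub_one hs.ne']
      congr 2
      ring
    have e2 : t ^ a ≤ (t + d) ^ a := Real.rpow_le_rpow ht.le (by linarith) ha.le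
    have e3 : 2 * (e * (t ^ a * (t + d) ^ (-(a + e)) / (t + d))) ≤
        2 * (e * (t + d) ^ (-e - 1)) := by
      rw [e1]
      gcongr
    refine le_trans ?_ (add_le_add_left e3 _)
    rw [Real.rpow_sub_one ht.ne', Real.rpow_sub_one hs.ne']
    have e4 : 2 * (e * (t ^ a * (t + d) ^ (-(a + e)) / (t + d))) +
        (a * (t ^ a / t) * (t + d) ^ (-(a + e)) -
          t ^ a * ((a + e) * ((t + d) ^ (-(a + e)) / (t + d)))) =
        (e * t + a * d) / (t + d) * (t ^ a / t * (t + d) ^ (-(a + e))) := by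
      field_simp
      ring
    rw [e4]
    gcongr
    rw [le_div_iff₀ hs]
    nlinarith [min_le_left a e, min_le_right a e]
  · refine ENNReal.ofReal_le_ofReal ?_
    simp only [sub_self, Real.zero_rpow ha.ne', zero_mul, sub_zero, zero_add, Real.one_rpow, one_mul]
    have h1 : 0 < (1 + d) ^ (-e) := by positivity
    have h2 : 0 < (1 + d) ^ (-(a + e)) := by positivity
    have h3 : (1 + d) ^ (-(a + e)) ≤ 1 :=
      Real.rpow_le_one_of_one_le_of_nonpos (by linarith) (by linarith)
    have h4 : (1 + d) ^ (-(a + e)) ≤ (1 + d) ^ (-e) :=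
      Real.rpow_le_rpow_of_exponent_le (by linarith) (by linarith)
    have h5 : 0 < d ^ (-e) := by positivity
    linarith

/-- The weight `(1 - |z|²) ^ a` integrated against one factor of Poisson type, with pole `ρ` in the
closed disc, and one factor with pole `w` in the open disc. -/
theorem exists_forelliRudin_bound {a e : ℝ} (ha : 0 < a) (he : 0 < e) :
    ∃ C : ℝ≥0∞, C ≠ ∞ ∧ ∀ ρ w : ℂ, ‖ρ‖ ≤ 1 → ‖w‖ < 1 →
      ∫⁻ z in ball (0 : ℂ) 1, ENNReal.ofReal ((1 - ‖z‖ ^ 2) ^ a *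
        ‖1 - (starRingEnd ℂ) z * w‖ ^ (-(a + e)) * (‖1 - (starRingEnd ℂ) z * ρ‖ ^ 2)⁻¹) ≤
      C * ENNReal.ofReal ((1 - ‖w‖) ^ (-e)) := by
  have hm : 0 < min a e := lt_min ha he
  set K : ℝ := 2 * Real.pi * (2 ^ |a - 1| * 2 ^ (a + e)) with hK
  have hK0 : 0 < K := by positivity
  refine ⟨ENNReal.ofReal K * ((ENNReal.ofReal (min a e))⁻¹ * ENNReal.ofReal 3), ?_,
    fun ρ w hρ hw => ?_⟩
  · refine ENNReal.mul_ne_top ENNReal.ofReal_ne_top (ENNReal.mul_ne_top ?_ ENNReal.ofReal_ne_top)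
    simpa using hm
  set d := 1 - ‖w‖ with hd
  have hd0 : 0 < d := sub_pos.2 hw
  have hnorm : ∀ r ∈ Set.Ioo (0 : ℝ) 1, ∀ θ, ‖circleMap 0 r θ‖ = r := fun r hr θ => by
    simp [abs_of_pos hr.1]
  have hpt : ∀ r ∈ Set.Ioo (0 : ℝ) 1, ∀ θ,
      ‖1 - (starRingEnd ℂ) (circleMap 0 r θ) * w‖ ^ (-(a + e)) ≤
        2 ^ (a + e) * (1 - r + d) ^ (-(a + e)) := fun r hr θ => by
    have h1 : 1 - r * ‖w‖ ≤ ‖1 - (starRingEnd ℂ) (circleMap 0 r θ) * w‖ := by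
      have := norm_sub_norm_le 1 ((starRingEnd ℂ) (circleMap 0 r θ) * w)
      rwa [norm_mul, RCLike.norm_conj, hnorm r hr, norm_one] at this
    have ht : 0 < 1 - r := sub_pos.2 hr.2
    have h2 : 2⁻¹ * (1 - r + d) ≤ ‖1 - (starRingEnd ℂ) (circleMap 0 r θ) * w‖ := by
      nlinarith [hr.1, norm_nonneg w]
    refine (Real.rpow_le_rpow_of_nonpos (by positivity) h2 (by linarith)).trans (le_of_eq ?_)
    rw [Real.mul_rpow (by norm_num) (by positivity), Real.inv_rpow (by norm_num),
      Real.rpow_neg (by norm_num), inv_inv]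
  calc _ = ∫⁻ r in Set.Ioo (0 : ℝ) 1, ENNReal.ofReal r * ∫⁻ θ in Set.Ioo (-Real.pi) Real.pi,
        ENNReal.ofReal ((1 - ‖circleMap 0 r θ‖ ^ 2) ^ a *
        ‖1 - (starRingEnd ℂ) (circleMap 0 r θ) * w‖ ^ (-(a + e)) *
        (‖1 - (starRingEnd ℂ) (circleMap 0 r θ) * ρ‖ ^ 2)⁻¹) := by
        refine setLIntegral_ball_eq_polar ?_ 0 1
        have : Measurable (starRingEnd ℂ) := Complex.continuous_conj.measurable
        fun_prop
    _ ≤ ∫⁻ r in Set.Ioo (0 : ℝ) 1, ENNReal.ofReal K *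
          ENNReal.ofReal ((1 - r) ^ (a - 1) * (1 - r + d) ^ (-(a + e))) := by
        refine setLIntegral_mono' measurableSet_Ioo fun r hr => ?_
        refine (mul_le_of_le_one_left' (ENNReal.ofReal_le_one.2 hr.2.le)).trans ?_
        have ht : 0 < 1 - r := sub_pos.2 hr.2
        have hr2 : 0 < 1 - r ^ 2 := by nlinarith [hr.1]
        have h1 : (1 - r ^ 2) ^ (a - 1) ≤ 2 ^ |a - 1| * (1 - r) ^ (a - 1) :=
          Real.rpow_le_rpow_abs_mul_rpow _ hr2 ht (by norm_num) (by nlinarith [hr.1])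
            (by nlinarith [hr.1])
        calc _ ≤ ∫⁻ θ in Set.Ioo (-Real.pi) Real.pi,
              ENNReal.ofReal ((1 - r ^ 2) ^ a * (2 ^ (a + e) * (1 - r + d) ^ (-(a + e)))) *
              ENNReal.ofReal ((‖1 - (starRingEnd ℂ) (circleMap 0 r θ) * ρ‖ ^ 2)⁻¹) := by
              refine lintegral_mono fun θ => ?_
              rw [← ENNReal.ofReal_mul (by positivity), hnorm r hr θ]
              refine ENNReal.ofReal_le_ofReal ?_
              gcongr
              exact hpt r hr θ
          _ ≤ ENNReal.ofReal ((1 - r ^ 2) ^ a * (2 ^ (a + e) * (1 - r + d) ^ (-(a + e)))) *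
              ENNReal.ofReal (2 * Real.pi / (1 - r ^ 2)) := by
              rw [lintegral_const_mul' _ _ ENNReal.ofReal_ne_top]
              gcongr
              exact setLIntegral_circle_inv_sq_le hρ hr.1 hr.2
          _ ≤ _ := by
              rw [← ENNReal.ofReal_mul (by positivity), ← ENNReal.ofReal_mul hK0.le]
              refine ENNReal.ofReal_le_ofReal ?_
              calc _ = 2 * Real.pi * (2 ^ (a + e) * (1 - r + d) ^ (-(a + e))) *
                    (1 - r ^ 2) ^ (a - 1) := by
                    rw [Real.rpow_sub_one hr2.ne']
                    ring
                _ ≤ 2 * Real.pi * (2 ^ (a + e) * (1 - r + d) ^ (-(a + e))) *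
                    (2 ^ |a - 1| * (1 - r) ^ (a - 1)) := by gcongr
                _ = _ := by rw [hK]; ring
    _ ≤ _ := by
        rw [lintegral_const_mul' _ _ ENNReal.ofReal_ne_top, mul_assoc, mul_assoc,
          ← ENNReal.ofReal_mul (by norm_num)]
        gcongr
        rw [← ENNReal.div_eq_inv_mul, ENNReal.le_div_iff_mul_le (Or.inl (by simpa using hm))
          (Or.inl (by simp)), mul_comm]
        exact setLIntegral_rpow_mul_rpow_le ha he hd0

/-- A weighted area integral of the Poisson kernel with pole `ζ`, against a kernel that concentrates
near `w`, is at most a constant times the Poisson kernel at `w` with the matching power of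
`1 - |w|²`. -/
theorem exists_poisson_area_bound {σ τ : ℝ} (hσ : -1 < σ) (hτ : -1 < τ) :
    ∃ C : ℝ≥0∞, C ≠ ∞ ∧ ∀ ζ w : ℂ, ‖ζ‖ = 1 → ‖w‖ < 1 →
      ∫⁻ z in ball (0 : ℂ) 1, ENNReal.ofReal ((1 - ‖z‖ ^ 2) / ‖ζ - z‖ ^ 2) * ENNReal.ofReal
        ((1 - ‖z‖ ^ 2) ^ σ / ‖1 - (starRingEnd ℂ) z * w‖ ^ (4 + σ + τ)) ≤
      C * (ENNReal.ofReal ((1 - ‖w‖ ^ 2) / ‖ζ - w‖ ^ 2) *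
        ENNReal.ofReal ((1 - ‖w‖ ^ 2) ^ (-(2 + τ)))) := by
  have ha : 0 < σ + 1 := by linarith
  have he : 0 < 1 + τ := by linarith
  obtain ⟨C, hC, H⟩ := exists_forelliRudin_bound ha he
  refine ⟨4 * C * ENNReal.ofReal (2 ^ |-(1 + τ)|), ENNReal.mul_ne_top
    (ENNReal.mul_ne_top (by simp) hC) ENNReal.ofReal_ne_top, fun ζ w hζ hw => ?_⟩
  have hk : 0 < ‖ζ - w‖ := by
    rw [norm_pos_iff, sub_ne_zero]
    rintro rfl
    linarith
  have hw2 : 0 < 1 - ‖w‖ ^ 2 := by nlinarith [norm_nonneg w]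
  have hw1 : 0 < 1 - ‖w‖ := sub_pos.2 hw
  have hmeas : Measurable (starRingEnd ℂ) := Complex.continuous_conj.measurable
  -- `|ζ - w|² ≤ 2 |ζ - z|² + 2 |1 - z̄ w|²` splits the integral into two with a single pole each.
  have hpt : ∀ z ∈ ball (0 : ℂ) 1,
      ENNReal.ofReal ((1 - ‖z‖ ^ 2) / ‖ζ - z‖ ^ 2) * ENNReal.ofReal
        ((1 - ‖z‖ ^ 2) ^ σ / ‖1 - (starRingEnd ℂ) z * w‖ ^ (4 + σ + τ)) ≤
      ENNReal.ofReal (2 * (‖ζ - w‖ ^ 2)⁻¹) * (ENNReal.ofReal ((1 - ‖z‖ ^ 2) ^ (σ + 1) *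
        ‖1 - (starRingEnd ℂ) z * w‖ ^ (-(σ + 1 + (1 + τ))) *
          (‖1 - (starRingEnd ℂ) z * w‖ ^ 2)⁻¹) +
        ENNReal.ofReal ((1 - ‖z‖ ^ 2) ^ (σ + 1) *
        ‖1 - (starRingEnd ℂ) z * w‖ ^ (-(σ + 1 + (1 + τ))) *
          (‖1 - (starRingEnd ℂ) z * ζ‖ ^ 2)⁻¹)) := fun z hz => by
    rw [mem_ball_zero_iff] at hz
    have hz2 : 0 < 1 - ‖z‖ ^ 2 := by nlinarith [norm_nonneg z]
    have hq := norm_one_sub_conj_mul_pos hz.le hw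
    have hp0 : ‖1 - (starRingEnd ℂ) z * ζ‖ ^ 2 = ‖ζ - z‖ ^ 2 := by
      rw [norm_one_sub_conj_mul_sq, hζ, norm_sub_rev]
      ring
    have hp : 0 < ‖ζ - z‖ := by
      rw [norm_pos_iff, sub_ne_zero]
      rintro rfl
      linarith
    have hzw : ‖z - w‖ ^ 2 ≤ ‖1 - (starRingEnd ℂ) z * w‖ ^ 2 := by
      rw [norm_one_sub_conj_mul_sq]
      nlinarith
    have htri : ‖ζ - w‖ ^ 2 ≤ 2 * ‖ζ - z‖ ^ 2 + 2 * ‖1 - (starRingEnd ℂ) z * w‖ ^ 2 := by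
      have h1 := norm_sub_le_norm_sub_add_norm_sub ζ z w
      have h2 := norm_nonneg (ζ - w)
      nlinarith [sq_nonneg (‖ζ - z‖ - ‖z - w‖), norm_nonneg (z - w)]
    rw [hp0]
    set q := ‖1 - (starRingEnd ℂ) z * w‖
    set p := ‖ζ - z‖
    set k := ‖ζ - w‖
    rw [← ENNReal.ofReal_add (by positivity) (by positivity), ← ENNReal.ofReal_mul (by positivity),
      ← ENNReal.ofReal_mul (by positivity)]
    refine ENNReal.ofReal_le_ofReal ?_
    have e1 : q ^ (4 + σ + τ) = q ^ (σ + 1 + (1 + τ)) * q ^ 2 := by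
      rw [← Real.rpow_two, ← Real.rpow_add hq]
      congr 1
      ring
    have e2 : (1 - ‖z‖ ^ 2) ^ (σ + 1) = (1 - ‖z‖ ^ 2) ^ σ * (1 - ‖z‖ ^ 2) :=
      Real.rpow_add_one hz2.ne' _
    rw [e1, e2, Real.rpow_neg hq.le]
    set Q := q ^ (σ + 1 + (1 + τ)) with hQdef
    have hQ : 0 < Q := Real.rpow_pos_of_pos hq _
    set Z := (1 - ‖z‖ ^ 2) ^ σ with hZdef
    have hZ : 0 < Z := Real.rpow_pos_of_pos hz2 _
    have e3 : 2 * (k ^ 2)⁻¹ * (Z * (1 - ‖z‖ ^ 2) * Q⁻¹ * (q ^ 2)⁻¹ +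
        Z * (1 - ‖z‖ ^ 2) * Q⁻¹ * (p ^ 2)⁻¹) =
        (2 * p ^ 2 + 2 * q ^ 2) / k ^ 2 * ((1 - ‖z‖ ^ 2) / p ^ 2 * (Z / (Q * q ^ 2))) := by
      field_simp
    rw [e3]
    refine le_mul_of_one_le_left (by positivity) ?_
    rwa [one_le_div (by positivity)]
  calc _ ≤ ∫⁻ z in ball (0 : ℂ) 1, ENNReal.ofReal (2 * (‖ζ - w‖ ^ 2)⁻¹) *
        (ENNReal.ofReal ((1 - ‖z‖ ^ 2) ^ (σ + 1) *
        ‖1 - (starRingEnd ℂ) z * w‖ ^ (-(σ + 1 + (1 + τ))) *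
          (‖1 - (starRingEnd ℂ) z * w‖ ^ 2)⁻¹) +
        ENNReal.ofReal ((1 - ‖z‖ ^ 2) ^ (σ + 1) *
        ‖1 - (starRingEnd ℂ) z * w‖ ^ (-(σ + 1 + (1 + τ))) *
          (‖1 - (starRingEnd ℂ) z * ζ‖ ^ 2)⁻¹)) := setLIntegral_mono' measurableSet_ball hpt
    _ ≤ ENNReal.ofReal (2 * (‖ζ - w‖ ^ 2)⁻¹) * (C * ENNReal.ofReal ((1 - ‖w‖) ^ (-(1 + τ))) +
          C * ENNReal.ofReal ((1 - ‖w‖) ^ (-(1 + τ)))) := by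
        rw [lintegral_const_mul' _ _ ENNReal.ofReal_ne_top, lintegral_add_left (by fun_prop)]
        gcongr
        · exact H w w hw.le hw
        · exact H ζ w hζ.le hw
    _ ≤ ENNReal.ofReal (2 * (‖ζ - w‖ ^ 2)⁻¹) * (C * ENNReal.ofReal
          (2 ^ |-(1 + τ)| * (1 - ‖w‖ ^ 2) ^ (-(1 + τ))) + C * ENNReal.ofReal
          (2 ^ |-(1 + τ)| * (1 - ‖w‖ ^ 2) ^ (-(1 + τ)))) := by
        have h1 : (1 - ‖w‖) ^ (-(1 + τ)) ≤ 2 ^ |-(1 + τ)| * (1 - ‖w‖ ^ 2) ^ (-(1 + τ)) :=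
          Real.rpow_le_rpow_abs_mul_rpow _ hw1 hw2 (by norm_num) (by nlinarith [norm_nonneg w])
            (by nlinarith [norm_nonneg w])
        gcongr
    _ = _ := by
        have e1 : (1 - ‖w‖ ^ 2) ^ (-(1 + τ)) = (1 - ‖w‖ ^ 2) * (1 - ‖w‖ ^ 2) ^ (-(2 + τ)) := by
          rw [mul_comm, ← Real.rpow_add_one hw2.ne']
          congr 1
          ring
        rw [e1, div_eq_mul_inv]
        simp only [ENNReal.ofReal_mul, hw2.le, two_pos.le, Real.rpow_nonneg two_pos.le,
          ENNReal.ofReal_ofNat]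
        ring

/-! ### Recovering the derivative from the oscillation -/

/-- The derivative at `z` is controlled by the weighted oscillation of `f` about `f z`: on the disc
of radius `(1 - |z|²) / 4` about `z` the weight is comparable to its value at `z`. -/
theorem exists_deriv_le_oscillation_bound (σ τ : ℝ) :
    ∃ C : ℝ≥0∞, C ≠ ∞ ∧ ∀ f : ℂ → ℂ, DifferentiableOn ℂ f (ball 0 1) → ∀ z : ℂ, ‖z‖ < 1 →
      ‖deriv f z‖ₑ ^ 2 ≤ C * (ENNReal.ofReal ((1 - ‖z‖ ^ 2) ^ σ) *
        ∫⁻ w in ball (0 : ℂ) 1, ‖f z - f w‖ₑ ^ 2 * ENNReal.ofReal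
          ((1 - ‖w‖ ^ 2) ^ τ / ‖1 - (starRingEnd ℂ) z * w‖ ^ (4 + σ + τ))) := by
  set K : ℝ := 2 ^ |τ| * 2 ^ |4 + σ + τ| with hK
  have hK0 : 0 < K := by positivity
  refine ⟨ENNReal.ofReal (256 * K), ENNReal.ofReal_ne_top, fun f hf z hz => ?_⟩
  set d := 1 - ‖z‖ ^ 2 with hd
  have hd0 : 0 < d := by nlinarith [norm_nonneg z]
  have hd1 : d ≤ 2 * (1 - ‖z‖) := by nlinarith [norm_nonneg z]
  have hsub : ball z (d / 4) ⊆ ball 0 1 := by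
    refine ball_subset_ball' ?_
    rw [dist_zero_right]
    linarith
  have hdiff : DifferentiableOn ℂ (dslope f z) (ball z (d / 4)) :=
    ((Complex.differentiableOn_dslope (isOpen_ball.mem_nhds (by simpa using hz))).2 hf).mono hsub
  have hmean := enorm_sq_mul_le_setLIntegral_ball hdiff (k := fun r => ENNReal.ofReal (r ^ 2))
    (by fun_prop)
  rw [dslope_same] at hmean
  have hmom : ∫⁻ r in Set.Ioo 0 (d / 4), ENNReal.ofReal r * ENNReal.ofReal (r ^ 2) =
      ENNReal.ofReal ((d / 4) ^ 4 / 4) := by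
    rw [setLIntegral_congr_fun (g := fun r => ENNReal.ofReal (r ^ 3)) measurableSet_Ioo,
      setLIntegral_Ioo_pow 3 (by positivity)]
    · norm_num
    · intro r hr
      simp only
      rw [← ENNReal.ofReal_mul hr.1.le]
      congr 1
      ring
  have hsl : ∀ w, ‖dslope f z w‖ₑ ^ 2 * ENNReal.ofReal (‖w - z‖ ^ 2) = ‖f z - f w‖ₑ ^ 2 :=
    fun w => by
      rw [ENNReal.ofReal_pow (norm_nonneg _), ofReal_norm, ← mul_pow, ← enorm_neg (f z - f w),
        neg_sub, ← sub_smul_dslope f z w, smul_eq_mul, enorm_mul, mul_comm]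
  simp only [hmom, hsl] at hmean
  have hwt : ∀ w ∈ ball z (d / 4), 1 ≤ K * d ^ (4 + σ) *
      ((1 - ‖w‖ ^ 2) ^ τ / ‖1 - (starRingEnd ℂ) z * w‖ ^ (4 + σ + τ)) := fun w hw => by
    have hw1 : ‖w‖ < 1 := by simpa using hsub hw
    rw [mem_ball, dist_eq_norm] at hw
    have h1 := abs_le.1 (abs_norm_sub_norm_le w z)
    have h2 : d ≤ 2 * (1 - ‖w‖ ^ 2) := by nlinarith [norm_nonneg w, norm_nonneg z]
    have h3 : 1 - ‖w‖ ^ 2 ≤ 2 * d := by nlinarith [norm_nonneg w, norm_nonneg z]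
    have hq := norm_one_sub_conj_mul_pos hz.le hw1
    have h4 : 1 - (starRingEnd ℂ) z * w = (d : ℂ) - (starRingEnd ℂ) z * (w - z) := by
      rw [hd]
      push_cast
      rw [← Complex.conj_mul' z]
      ring
    have h5 : ‖(starRingEnd ℂ) z * (w - z)‖ ≤ d / 4 := by
      rw [norm_mul, RCLike.norm_conj]
      nlinarith [norm_nonneg z, norm_nonneg (w - z)]
    have h6 : ‖(d : ℂ)‖ = d := by rw [Complex.norm_real, Real.norm_eq_abs, abs_of_pos hd0]
    have h7 : ‖1 - (starRingEnd ℂ) z * w‖ ≤ 2 * d := by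
      rw [h4]
      refine (norm_sub_le _ _).trans ?_
      linarith
    have h8 : d ≤ 2 * ‖1 - (starRingEnd ℂ) z * w‖ := by
      rw [h4]
      have := norm_sub_norm_le (d : ℂ) ((starRingEnd ℂ) z * (w - z))
      linarith
    have h9 := Real.rpow_le_rpow_abs_mul_rpow τ hd0 (by linarith) one_le_two h2 h3
    have h10 := Real.rpow_le_rpow_abs_mul_rpow (4 + σ + τ) hq hd0 one_le_two h7 h8
    have e1 : d ^ (4 + σ + τ) = d ^ (4 + σ) * d ^ τ := Real.rpow_add hd0 _ _
    rw [← mul_div_assoc, one_le_div (by positivity)]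
    calc _ ≤ _ := h10
      _ = 2 ^ |4 + σ + τ| * d ^ (4 + σ) * d ^ τ := by rw [e1]; ring
      _ ≤ 2 ^ |4 + σ + τ| * d ^ (4 + σ) * (2 ^ |τ| * (1 - ‖w‖ ^ 2) ^ τ) := by gcongr
      _ = _ := by rw [hK]; ring
  calc ‖deriv f z‖ₑ ^ 2 ≤ ENNReal.ofReal (256 / d ^ 4) * (‖deriv f z‖ₑ ^ 2 *
        (ENNReal.ofReal (2 * Real.pi) * ENNReal.ofReal ((d / 4) ^ 4 / 4))) := by
        rw [mul_left_comm]
        refine le_mul_of_one_le_right' ?_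
        rw [← ENNReal.ofReal_mul (by positivity), ← ENNReal.ofReal_mul (by positivity),
          ENNReal.one_le_ofReal]
        have : 256 / d ^ 4 * (2 * Real.pi * ((d / 4) ^ 4 / 4)) = Real.pi / 2 := by
          field_simp
          norm_num
        rw [this]
        linarith [Real.pi_gt_three]
    _ ≤ ENNReal.ofReal (256 / d ^ 4) * ∫⁻ w in ball z (d / 4), ‖f z - f w‖ₑ ^ 2 := by gcongr
    _ ≤ ENNReal.ofReal (256 / d ^ 4) * ∫⁻ w in ball z (d / 4), ENNReal.ofReal (K * d ^ (4 + σ)) *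
        (‖f z - f w‖ₑ ^ 2 * ENNReal.ofReal
          ((1 - ‖w‖ ^ 2) ^ τ / ‖1 - (starRingEnd ℂ) z * w‖ ^ (4 + σ + τ))) := by
        refine mul_le_mul_right (setLIntegral_mono' measurableSet_ball fun w hw => ?_) _
        rw [mul_left_comm, ← ENNReal.ofReal_mul (by positivity)]
        exact le_mul_of_one_le_right' (ENNReal.one_le_ofReal.2 (hwt w hw))
    _ ≤ ENNReal.ofReal (256 / d ^ 4) * ∫⁻ w in ball 0 1, ENNReal.ofReal (K * d ^ (4 + σ)) *
        (‖f z - f w‖ₑ ^ 2 * ENNReal.ofReal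
          ((1 - ‖w‖ ^ 2) ^ τ / ‖1 - (starRingEnd ℂ) z * w‖ ^ (4 + σ + τ))) := by gcongr
    _ = _ := by
        rw [lintegral_const_mul' _ _ ENNReal.ofReal_ne_top, ← mul_assoc, ← mul_assoc,
          ← ENNReal.ofReal_mul (by positivity), ← ENNReal.ofReal_mul (by positivity)]
        congr 2
        rw [Real.rpow_add hd0, show (4 : ℝ) = ((4 : ℕ) : ℝ) by norm_num, Real.rpow_natCast]
        field_simp

/-! ### The double integral over the disc -/

theorem lintegral_weightedArea (s : ℝ) (F : ℂ → ℝ≥0∞) :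
    ∫⁻ z, F z ∂(weightedArea s) =
      ∫⁻ z in ball (0 : ℂ) 1, ENNReal.ofReal ((1 - ‖z‖ ^ 2) ^ s) * F z := by
  rw [weightedArea, diskArea, lintegral_withDensity_eq_lintegral_mul_non_measurable]
  · rfl
  · fun_prop
  · exact Filter.Eventually.of_forall fun z => ENNReal.ofReal_lt_top

theorem measurable_poissonIntegrand :
    Measurable (Function.uncurry fun (z : ℂ) (ζ : sphere (0 : ℂ) 1) =>
      ENNReal.ofReal ((1 - ‖z‖ ^ 2) / ‖(ζ : ℂ) - z‖ ^ 2)) := by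
  unfold Function.uncurry
  fun_prop

theorem measurable_poissonIntegral (μ : Measure (sphere (0 : ℂ) 1)) [IsFiniteMeasure μ] :
    Measurable (poissonIntegral μ) := by
  unfold poissonIntegral
  exact (measurable_poissonIntegrand.lintegral_prod_right' (ν := μ)).div_const _

theorem lintegral_ofReal_norm_sq_mul_poissonIntegral (μ : Measure (sphere (0 : ℂ) 1)) (h : ℂ → ℂ) :
    ∫⁻ z, ENNReal.ofReal (‖h z‖ ^ 2) * poissonIntegral μ z ∂diskArea =
      ∫⁻ z in ball (0 : ℂ) 1, ‖h z‖ₑ ^ 2 * poissonIntegral μ z := by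
  simp only [diskArea, ENNReal.ofReal_pow (norm_nonneg _), ofReal_norm]

/-- The bound for the Poisson kernel at a single boundary point, averaged over `μ`. -/
theorem exists_poissonIntegral_area_bound {σ τ : ℝ} (hσ : -1 < σ) (hτ : -1 < τ) :
    ∃ C : ℝ≥0∞, C ≠ ∞ ∧ ∀ (μ : Measure (sphere (0 : ℂ) 1)) [IsFiniteMeasure μ] (w : ℂ), ‖w‖ < 1 →
      ∫⁻ z in ball (0 : ℂ) 1, poissonIntegral μ z * ENNReal.ofReal
        ((1 - ‖z‖ ^ 2) ^ σ / ‖1 - (starRingEnd ℂ) z * w‖ ^ (4 + σ + τ)) ≤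
      C * (poissonIntegral μ w * ENNReal.ofReal ((1 - ‖w‖ ^ 2) ^ (-(2 + τ)))) := by
  obtain ⟨C, hC, H⟩ := exists_poisson_area_bound hσ hτ
  refine ⟨C, hC, fun μ _ w hw => ?_⟩
  have hconj : Measurable (starRingEnd ℂ) := Complex.continuous_conj.measurable
  have hP := measurable_poissonIntegrand
  set k : ℂ → ℝ≥0∞ := fun z => ENNReal.ofReal
    ((1 - ‖z‖ ^ 2) ^ σ / ‖1 - (starRingEnd ℂ) z * w‖ ^ (4 + σ + τ)) with hk
  have hkm : Measurable k := by fun_prop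
  set c := (ENNReal.ofReal (2 * Real.pi))⁻¹ with hc
  have hc0 : c ≠ ∞ := by
    rw [hc, ENNReal.inv_ne_top, ENNReal.ofReal_ne_zero_iff]
    positivity
  calc ∫⁻ z in ball (0 : ℂ) 1, poissonIntegral μ z * k z
      = c * ∫⁻ z in ball (0 : ℂ) 1, ∫⁻ ζ : sphere (0 : ℂ) 1,
          ENNReal.ofReal ((1 - ‖z‖ ^ 2) / ‖(ζ : ℂ) - z‖ ^ 2) * k z ∂μ := by
        rw [← lintegral_const_mul' _ _ hc0]
        refine lintegral_congr fun z => ?_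
        rw [lintegral_mul_const _ (hP.of_uncurry_left (x := z)), poissonIntegral, div_eq_mul_inv]
        ring
    _ = c * ∫⁻ ζ : sphere (0 : ℂ) 1, ∫⁻ z in ball (0 : ℂ) 1,
          ENNReal.ofReal ((1 - ‖z‖ ^ 2) / ‖(ζ : ℂ) - z‖ ^ 2) * k z ∂volume ∂μ := by
        rw [lintegral_lintegral_swap]
        exact (hP.mul (hkm.comp measurable_fst)).aemeasurable
    _ ≤ c * ∫⁻ ζ : sphere (0 : ℂ) 1, C * (ENNReal.ofReal ((1 - ‖w‖ ^ 2) / ‖(ζ : ℂ) - w‖ ^ 2) *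
          ENNReal.ofReal ((1 - ‖w‖ ^ 2) ^ (-(2 + τ)))) ∂μ := by
        gcongr with ζ
        exact H ζ w (by simp) hw
    _ = _ := by
        rw [lintegral_const_mul' _ _ hC, lintegral_mul_const' _ _ ENNReal.ofReal_ne_top,
          poissonIntegral, div_eq_mul_inv]
        ring

/-- Tonelli's theorem for the double integral: the oscillation of `f` about `f z` is integrated
first. -/
theorem double_lintegral_eq_oscillation (σ τ : ℝ) (μ : Measure (sphere (0 : ℂ) 1))
    [IsFiniteMeasure μ] {f : ℂ → ℂ} (hf : Measurable f) :
    ∫⁻ w, ∫⁻ z, ENNReal.ofReal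
        (‖f z - f w‖ ^ 2 / ‖1 - (starRingEnd ℂ) z * w‖ ^ (4 + σ + τ)) * poissonIntegral μ z
        ∂(weightedArea σ) ∂(weightedArea τ) =
      ∫⁻ z in ball (0 : ℂ) 1, poissonIntegral μ z * (ENNReal.ofReal ((1 - ‖z‖ ^ 2) ^ σ) *
        ∫⁻ w in ball (0 : ℂ) 1, ‖f z - f w‖ₑ ^ 2 * ENNReal.ofReal
          ((1 - ‖w‖ ^ 2) ^ τ / ‖1 - (starRingEnd ℂ) z * w‖ ^ (4 + σ + τ))) := by
  have hconj : Measurable (starRingEnd ℂ) := Complex.continuous_conj.measurable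
  have hP := measurable_poissonIntegral μ
  simp only [lintegral_weightedArea]
  calc _ = ∫⁻ w in ball (0 : ℂ) 1, ∫⁻ z in ball (0 : ℂ) 1, ENNReal.ofReal ((1 - ‖w‖ ^ 2) ^ τ) *
        (ENNReal.ofReal ((1 - ‖z‖ ^ 2) ^ σ) * (ENNReal.ofReal
        (‖f z - f w‖ ^ 2 / ‖1 - (starRingEnd ℂ) z * w‖ ^ (4 + σ + τ)) *
          poissonIntegral μ z)) :=
        lintegral_congr fun w => (lintegral_const_mul' _ _ ENNReal.ofReal_ne_top).symm
    _ = ∫⁻ z in ball (0 : ℂ) 1, ∫⁻ w in ball (0 : ℂ) 1, ENNReal.ofReal ((1 - ‖w‖ ^ 2) ^ τ) *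
        (ENNReal.ofReal ((1 - ‖z‖ ^ 2) ^ σ) * (ENNReal.ofReal
        (‖f z - f w‖ ^ 2 / ‖1 - (starRingEnd ℂ) z * w‖ ^ (4 + σ + τ)) *
          poissonIntegral μ z)) := by
        refine lintegral_lintegral_swap (Measurable.aemeasurable ?_)
        unfold Function.uncurry
        fun_prop
    _ = _ := by
        refine lintegral_congr fun z => ?_
        rw [← lintegral_const_mul _ (by fun_prop), ← lintegral_const_mul _ (by fun_prop)]
        refine setLIntegral_congr_fun measurableSet_ball fun w hw => ?_
        have hw2 : 0 < 1 - ‖w‖ ^ 2 := by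
          rw [mem_ball_zero_iff] at hw
          nlinarith [norm_nonneg w]
        simp only [div_eq_mul_inv]
        rw [ENNReal.ofReal_mul (by positivity), ENNReal.ofReal_mul (by positivity),
          ENNReal.ofReal_pow (norm_nonneg _), ofReal_norm]
        ring

/-- The equivalence for a function that is measurable on all of `ℂ`, as Tonelli's theorem needs. -/
theorem lintegral_deriv_lt_top_iff_double_lintegral_lt_top {σ τ : ℝ} (hσ : -1 < σ) (hτ : -1 < τ)
    (μ : Measure (sphere (0 : ℂ) 1)) [IsFiniteMeasure μ] {f : ℂ → ℂ} (hfm : Measurable f)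
    (hf : DifferentiableOn ℂ f (ball 0 1)) :
    ∫⁻ z in ball (0 : ℂ) 1, ‖deriv f z‖ₑ ^ 2 * poissonIntegral μ z < ∞ ↔
      ∫⁻ w, ∫⁻ z, ENNReal.ofReal
          (‖f z - f w‖ ^ 2 / ‖1 - (starRingEnd ℂ) z * w‖ ^ (4 + σ + τ)) * poissonIntegral μ z
        ∂(weightedArea σ) ∂(weightedArea τ) < ∞ := by
  have hconj : Measurable (starRingEnd ℂ) := Complex.continuous_conj.measurable
  have hP := measurable_poissonIntegral μ
  have hd := measurable_deriv f
  rw [double_lintegral_eq_oscillation σ τ μ hfm]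
  constructor
  · obtain ⟨C₁, hC₁, H₁⟩ := exists_oscillation_le_deriv_bound hσ hτ
    obtain ⟨C₂, hC₂, H₂⟩ := exists_poissonIntegral_area_bound hσ hτ
    intro h
    refine lt_of_le_of_lt ?_ (ENNReal.mul_lt_top (ENNReal.mul_lt_top hC₁.lt_top hC₂.lt_top) h)
    calc _ ≤ ∫⁻ z in ball (0 : ℂ) 1, C₁ * ∫⁻ w in ball (0 : ℂ) 1,
          (‖deriv f w‖ₑ ^ 2 * ENNReal.ofReal ((1 - ‖w‖ ^ 2) ^ (2 + τ))) *
          (poissonIntegral μ z * ENNReal.ofReal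
            ((1 - ‖z‖ ^ 2) ^ σ / ‖1 - (starRingEnd ℂ) z * w‖ ^ (4 + σ + τ))) := by
          refine setLIntegral_mono' measurableSet_ball fun z hz => ?_
          rw [mem_ball_zero_iff] at hz
          have hz2 : 0 < 1 - ‖z‖ ^ 2 := by nlinarith [norm_nonneg z]
          calc _ ≤ poissonIntegral μ z * (ENNReal.ofReal ((1 - ‖z‖ ^ 2) ^ σ) *
                (C₁ * ∫⁻ w in ball (0 : ℂ) 1, ‖deriv f w‖ₑ ^ 2 * ENNReal.ofReal
                  ((1 - ‖w‖ ^ 2) ^ (2 + τ) /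
                    ‖1 - (starRingEnd ℂ) z * w‖ ^ (4 + σ + τ)))) := by
                gcongr
                exact H₁ f hfm hf z hz
            _ = C₁ * (poissonIntegral μ z * (ENNReal.ofReal ((1 - ‖z‖ ^ 2) ^ σ) *
                ∫⁻ w in ball (0 : ℂ) 1, ‖deriv f w‖ₑ ^ 2 * ENNReal.ofReal
                  ((1 - ‖w‖ ^ 2) ^ (2 + τ) /
                    ‖1 - (starRingEnd ℂ) z * w‖ ^ (4 + σ + τ)))) := by ring
            _ = _ := by
                congr 1
                rw [← lintegral_const_mul _ (by fun_prop), ← lintegral_const_mul _ (by fun_prop)]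
                refine setLIntegral_congr_fun measurableSet_ball fun w hw => ?_
                have hw2 : 0 < 1 - ‖w‖ ^ 2 := by
                  rw [mem_ball_zero_iff] at hw
                  nlinarith [norm_nonneg w]
                simp only [div_eq_mul_inv]
                rw [ENNReal.ofReal_mul (by positivity), ENNReal.ofReal_mul (by positivity)]
                ring
      _ = C₁ * ∫⁻ w in ball (0 : ℂ) 1, ∫⁻ z in ball (0 : ℂ) 1,
          (‖deriv f w‖ₑ ^ 2 * ENNReal.ofReal ((1 - ‖w‖ ^ 2) ^ (2 + τ))) *
          (poissonIntegral μ z * ENNReal.ofReal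
            ((1 - ‖z‖ ^ 2) ^ σ / ‖1 - (starRingEnd ℂ) z * w‖ ^ (4 + σ + τ))) := by
          rw [lintegral_const_mul' _ _ hC₁, lintegral_lintegral_swap]
          refine Measurable.aemeasurable ?_
          unfold Function.uncurry
          fun_prop
      _ ≤ C₁ * ∫⁻ w in ball (0 : ℂ) 1, C₂ * (‖deriv f w‖ₑ ^ 2 * poissonIntegral μ w) := by
          refine mul_le_mul_right (setLIntegral_mono' measurableSet_ball fun w hw => ?_) _
          rw [mem_ball_zero_iff] at hw
          have hw2 : 0 < 1 - ‖w‖ ^ 2 := by nlinarith [norm_nonneg w]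
          rw [lintegral_const_mul _ (by fun_prop)]
          refine (mul_le_mul_right (H₂ μ w hw) _).trans (le_of_eq ?_)
          have e1 : ENNReal.ofReal ((1 - ‖w‖ ^ 2) ^ (2 + τ)) *
              ENNReal.ofReal ((1 - ‖w‖ ^ 2) ^ (-(2 + τ))) = 1 := by
            rw [← ENNReal.ofReal_mul (by positivity), ← Real.rpow_add hw2]
            simp
          calc _ = C₂ * (‖deriv f w‖ₑ ^ 2 * poissonIntegral μ w) *
                (ENNReal.ofReal ((1 - ‖w‖ ^ 2) ^ (2 + τ)) *
                  ENNReal.ofReal ((1 - ‖w‖ ^ 2) ^ (-(2 + τ)))) := by ring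
            _ = _ := by rw [e1, mul_one]
      _ = _ := by rw [lintegral_const_mul' _ _ hC₂, mul_assoc]
  · obtain ⟨C, hC, H⟩ := exists_deriv_le_oscillation_bound σ τ
    intro h
    refine lt_of_le_of_lt ?_ (ENNReal.mul_lt_top hC.lt_top h)
    rw [← lintegral_const_mul' _ _ hC]
    refine setLIntegral_mono' measurableSet_ball fun z hz => ?_
    rw [mul_comm, mul_left_comm]
    gcongr
    exact H f hf z (by simpa using hz)

theorem theorem3p3 (σ τ : ℝ) (hσ : -1 < σ) (hτ : -1 < τ)
    (μ : Measure (sphere (0 : ℂ) 1)) [IsFiniteMeasure μ] (hμ : μ ≠ 0)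
    (f : ℂ → ℂ) (hf : AnalyticOnNhd ℂ f (ball 0 1)) :
    f ∈ DirichletTypeSpace μ ↔
      ∫⁻ w, ∫⁻ z,
          ENNReal.ofReal
              (‖f z - f w‖ ^ 2 / ‖1 - (starRingEnd ℂ) z * w‖ ^ (4 + σ + τ)) *
            poissonIntegral μ z
        ∂(weightedArea σ) ∂(weightedArea τ) < ∞ := by
  -- `f` is arbitrary off the disc, so it is replaced by a measurable function that agrees with it on
  -- the disc.
  set g := (ball (0 : ℂ) 1).indicator f with hg
  have hfd : DifferentiableOn ℂ f (ball 0 1) := hf.differentiableOn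
  have hgf : Set.EqOn g f (ball 0 1) := fun z hz => Set.indicator_of_mem hz f
  have hderiv : Set.EqOn (deriv g) (deriv f) (ball 0 1) := fun z hz =>
    (hgf.eventuallyEq_of_mem (isOpen_ball.mem_nhds hz)).deriv_eq
  have hmain := lintegral_deriv_lt_top_iff_double_lintegral_lt_top hσ hτ μ
    hfd.measurable_indicator_ball (hfd.congr hgf)
  have hleft : ∫⁻ z in ball (0 : ℂ) 1, ‖deriv g z‖ₑ ^ 2 * poissonIntegral μ z =
      ∫⁻ z in ball (0 : ℂ) 1, ‖deriv f z‖ₑ ^ 2 * poissonIntegral μ z :=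
    setLIntegral_congr_fun measurableSet_ball fun z hz => by simp only [hderiv hz]
  have hright : ∫⁻ w, ∫⁻ z, ENNReal.ofReal
        (‖g z - g w‖ ^ 2 / ‖1 - (starRingEnd ℂ) z * w‖ ^ (4 + σ + τ)) * poissonIntegral μ z
        ∂(weightedArea σ) ∂(weightedArea τ) =
      ∫⁻ w, ∫⁻ z, ENNReal.ofReal
        (‖f z - f w‖ ^ 2 / ‖1 - (starRingEnd ℂ) z * w‖ ^ (4 + σ + τ)) * poissonIntegral μ z
        ∂(weightedArea σ) ∂(weightedArea τ) := by
    simp only [lintegral_weightedArea]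
    refine setLIntegral_congr_fun measurableSet_ball fun w hw => ?_
    congr 1
    refine setLIntegral_congr_fun measurableSet_ball fun z hz => ?_
    simp only [hgf hz, hgf hw]
  rw [← hright, ← hmain, hleft, ← lintegral_ofReal_norm_sq_mul_poissonIntegral]
  exact ⟨fun h => h.2, fun h => ⟨hf, h⟩⟩
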